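/- **Setting.** A database is $d=(x_1,\dots,x_n)\in(\mathbb R^p)^n$; two databases are adjacent if they agree except in one entry. A mechanism $\mathcal M$ is $(\varepsilon,\delta)$-differentially private if $\Pr[\mathcal M(d)\in S]\le e^{\varepsilon}\Pr[\mathcal M(d')\in S]+\delta$ for all adjacent $d,d'$ and all measurable $S$. The *basic dp-GAN* procedure trains a discriminator $D_w$ (parameters $w\in\mathbb R^{d_w}$) and a generator $G_\theta$ (parameters $\theta\in\mathbb R^{d_\theta}$) on $d$, starting from fixed parameters. Each iteration of its main loop does the following. 1. It updates $w$ $n_{\rm critic}$ times. For each update every index $i\in\{1,\dots,n\}$ is put into the batch $I$ independently with probability $q=m/n$ (Poisson subsampling). For $i\in I$ a latent $z_i\sim p_z$ and $\rho_i\sim\mathcal U[0,1]$ are drawn, and with $\hat x_i=\rho_i x_i+(1-\rho_i)G_\theta(z_i)$ the gradient $$g_i=\nabla_w\Big(D_w(G_\theta(z_i))-D_w(x_i)+\lambda\,(\|\nabla_{\hat x}D_w(\hat x_i)\|_2-1)^2\Big)$$ is clipped to $\bar g_i=g_i/\max(1,\|g_i\|_2/C)$. Then $w$ is updated by Adam with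 the gradient $\frac1m\big(\sum_{i\in I}\bar g_i+\sum_{j=1}^{r}\xi_j\big)$, where $\xi_1,\dots,\xi_r$ are independent with law $\mathcal N(0,(\sigma C)^2\mathcal I)$ and $r\ge1$ is fixed ($r=1$: one noise vector per batch; $r=m$: one per batch slot). All draws are independent. 2. It updates $\theta$ by Adam with the gradient $\nabla_\theta\frac1m\sum_{i=1}^m-D_w(G_\theta(z^{(i)}))$, where $z^{(1)},\dots,z^{(m)}\sim p_z$ are fresh and independent. The loop stops when a convergence test, which may depend on the history of $\theta$ in any measurable way, succeeds, or when a privacy accountant (any deterministic function of its list of updates $(\sigma,m,d_w)$ and of the query $\varepsilon_0$) reports more than $\delta_0$, and in any case after at most $t$ iterations. The output is $\theta$. **Theorem.** For every $c>0$ there is a constant $K>0$, depending only on $c$, such that the following holds. Let $t,n_{\rm critic},m,r\ge1$, $C>0$, $\varepsilon>0$, $0<\delta<1$, $q=m/n$, and let the noise scale $\sigma$ satisfy $$\sigma\ge\frac{\sqrt{2\log(1.25/\delta)}}{\varepsilon},\qquad \sigma\ge1,\qquad q\sigma\le\tfrac1{16}.$$ If $\;q\varepsilon\sqrt{n_{\rm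 critic}\,t}\le c\,q^2n_{\rm critic}\,t\;$ and $\;q\varepsilon\sqrt{n_{\rm critic}\,t}\le c\,\log(1/\delta)$, then the basic dp-GAN procedure with at most $t$ main-loop iterations is $$\big(K\,q\,\varepsilon\sqrt{n_{\rm critic}\,t},\ \delta\big)\text{-differentially private.}$$ In particular, for a fixed number $n_{\rm critic}$ of critic iterations it is $(O(q\varepsilon\sqrt t),\delta)$-differentially private. The constant does not depend on the networks, the dimensions, the data, $C$, $\sigma$, $\varepsilon$, $\delta$, $q$, $t$ or the remaining parameters. -/

import Mathlib

open MeasureTheory ProbabilityTheory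

noncomputable section

namespace DPGAN

/-! ### Differential privacy -/

/-- Two databases with `n` entries are adjacent if they are identical except for (at most) one
single entry. -/
def Adjacent {X : Type*} {n : ℕ} (d d' : Fin n → X) : Prop :=
  ∃ i, ∀ j, j ≠ i → d j = d' j

/-- `(ε, δ)`-differential privacy of a randomized mechanism, given by its output law `M d` on every
database `d`. -/
def IsDP {X R : Type*} [MeasurableSpace R] {n : ℕ} (M : (Fin n → X) → Measure R) (ε δ : ℝ) :
    Prop :=
  ∀ d d' : Fin n → X, Adjacent d d' → ∀ S : Set R, MeasurableSet S →
    M d S ≤ ENNReal.ofReal (Real.exp ε) * M d' S + ENNReal.ofReal δ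

/-! ### Adam -/

/-- Euclidean space `ℝ^d`. -/
abbrev E (d : ℕ) : Type := EuclideanSpace ℝ (Fin d)

/-- State of the Adam optimizer: first moment estimate, second moment estimate, step counter. -/
abbrev AdamState (d : ℕ) : Type := E d × E d × ℕ

/-- Initial state of Adam. -/
def adamInit (d : ℕ) : AdamState d := (0, 0, 0)

/-- Update of the moment estimates and of the step counter of Adam with the gradient `g`. -/
def adamState {d : ℕ} (β₁ β₂ : ℝ) (g : E d) (a : AdamState d) : AdamState d :=
  (β₁ • a.1 + (1 - β₁) • g,
   WithLp.toLp 2 (fun i => β₂ * a.2.1 i + (1 - β₂) * g i ^ 2),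
   a.2.2 + 1)

/-- Update of the parameter `w` by Adam with step size `α`, where `a` is the already updated state;
`κ` is the numerical stabilizer in the denominator. -/
def adamParam {d : ℕ} (α β₁ β₂ κ : ℝ) (w : E d) (a : AdamState d) : E d :=
  WithLp.toLp 2 (fun i =>
    w i - α * (a.1 i / (1 - β₁ ^ a.2.2)) / (Real.sqrt (a.2.1 i / (1 - β₂ ^ a.2.2)) + κ))

/-! ### The training procedure -/

/-- Networks, hyper-parameters and control data of the training procedure.
`p` is the dimension of the data, `dw` and `dθ` are the numbers of parameters of the discriminator
and of the generator, and `Z` is the latent space. -/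
structure Config (p dw dθ : ℕ) (Z : Type*) [MeasurableSpace Z] where
  /-- the discriminator `D_w(x)` -/
  D : E dw → E p → ℝ
  /-- the generator `G_θ(z)` -/
  G : E dθ → Z → E p
  /-- the latent distribution -/
  pz : Measure Z
  /-- initial parameters of the discriminator -/
  w₀ : E dw
  /-- initial parameters of the generator -/
  θ₀ : E dθ
  /-- coefficient of the gradient penalty -/
  lam : ℝ
  /-- number of critic iterations per generator iteration -/
  nCritic : ℕ
  /-- (expected) batch size -/
  m : ℕ
  /-- number of independent noise vectors that are added to the batch gradient -/
  r : ℕ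
  /-- step size of Adam -/
  α : ℝ
  /-- first decay rate of Adam -/
  β₁ : ℝ
  /-- second decay rate of Adam -/
  β₂ : ℝ
  /-- stabilizer of Adam -/
  κ : ℝ
  /-- gradient clipping bound -/
  C : ℝ
  /-- noise scale -/
  σ : ℝ
  /-- convergence test: the argument is the number `k` of completed main-loop iterations and the
  history of `θ`, whose entries `0, …, k` are the parameters so far (later entries are still `0`) -/
  converged : ℕ → (ℕ → E dθ) → Prop
  /-- the privacy accountant: its answer to a query `ε₀` after the listed updates -/
  accountant : List (ℝ × ℕ × ℕ) → ℝ → ℝ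
  /-- total privacy budget, `ε` part -/
  ε₀ : ℝ
  /-- total privacy budget, `δ` part -/
  δ₀ : ℝ

/-- State of the training procedure: parameters `w` of the discriminator, its Adam state,
parameters `θ` of the generator, its Adam state, history of `θ`. -/
abbrev State (dw dθ : ℕ) : Type := E dw × AdamState dw × E dθ × AdamState dθ × (ℕ → E dθ)

/-- Gradient clipping `g / max(1, ‖g‖ / C)`. -/
def clip {d : ℕ} (C : ℝ) (g : E d) : E d := (max 1 (‖g‖ / C))⁻¹ • g

namespace Config

variable {p dw dθ n : ℕ} {Z : Type*} [MeasurableSpace Z] (cfg : Config p dw dθ Z)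

/-- The improved WGAN loss of the discriminator at the real sample `x`, the latent `z` and the
interpolation weight `ρ`. -/
def loss (θ : E dθ) (x : E p) (z : Z) (ρ : ℝ) (w : E dw) : ℝ :=
  cfg.D w (cfg.G θ z) - cfg.D w x
    + cfg.lam * (‖gradient (cfg.D w) (ρ • x + (1 - ρ) • cfg.G θ z)‖ - 1) ^ 2

/-- Gradient of the loss of one sample with respect to the parameters of the discriminator. -/
def sampleGrad (x : E p) (w : E dw) (θ : E dθ) (z : Z) (ρ : ℝ) : E dw :=
  gradient (cfg.loss θ x z ρ) w

/-- Gradient of the generator's loss `(1/m) ∑ᵢ -D_w(G_θ(zᵢ))` with respect to `θ`. -/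
def generatorGrad (w : E dw) (θ : E dθ) (z : Fin cfg.m → Z) : E dθ :=
  gradient (fun θ' => (1 / (cfg.m : ℝ)) * ∑ i, -cfg.D w (cfg.G θ' (z i))) θ

/-- Fresh randomness of one discriminator update: for each of the `n` entries of the database
whether it is selected, its latent and its interpolation weight, and the noise vectors. -/
abbrev CriticSeed (n : ℕ) : Type _ :=
  (Fin n → Bool) × (Fin n → Z) × (Fin n → ℝ) × (Fin cfg.r → E dw)

/-- Law of the randomness of one discriminator update. All components are independent; an entry is
selected with probability `q = m / n` (cut off at `1`), the latents have law `pz`, the interpolation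
weights are uniform on `[0, 1]`, each noise vector has law `N(0, (σC)² I)`. -/
def criticSeedLaw (n : ℕ) : Measure (cfg.CriticSeed n) :=
  (Measure.pi fun _ : Fin n =>
      bernoulliMeasure true false (Set.projIcc (0 : ℝ) 1 zero_le_one ((cfg.m : ℝ) / n))).prod
    ((Measure.pi fun _ : Fin n => cfg.pz).prod
      ((Measure.pi fun _ : Fin n => (volume : Measure ℝ).restrict (Set.Icc 0 1)).prod
        (Measure.pi fun _ : Fin cfg.r =>
          (stdGaussian (E dw)).map fun ξ => (cfg.σ * cfg.C) • ξ)))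

/-- The perturbed batch gradient: the clipped gradients of the selected entries are summed, the
noise is added, and the result is divided by `m`. -/
def batchGrad (d : Fin n → E p) (w : E dw) (θ : E dθ) (ω : cfg.CriticSeed n) : E dw :=
  (1 / (cfg.m : ℝ)) •
    ((∑ i, if ω.1 i = true then
        clip cfg.C (cfg.sampleGrad (d i) w θ (ω.2.1 i) (ω.2.2.1 i)) else 0)
      + ∑ j, ω.2.2.2 j)

/-- One update of the discriminator. -/
def criticUpdate (d : Fin n → E p) (s : State dw dθ) (ω : cfg.CriticSeed n) : State dw dθ :=
  let a := adamState cfg.β₁ cfg.β₂ (cfg.batchGrad d s.1 s.2.2.1 ω) s.2.1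
  (adamParam cfg.α cfg.β₁ cfg.β₂ cfg.κ s.1 a, a, s.2.2)

/-- `j` consecutive updates of the discriminator from the state `s`, with fresh randomness each. -/
def criticLoop (d : Fin n → E p) : ℕ → State dw dθ → Measure (State dw dθ)
  | 0, s => Measure.dirac s
  | j + 1, s => ((cfg.criticSeedLaw n).map (cfg.criticUpdate d s)).bind (criticLoop d j)

/-- The update of the generator that completes main-loop iteration number `k + 1`. -/
def generatorUpdate (k : ℕ) (s : State dw dθ) (z : Fin cfg.m → Z) : State dw dθ :=
  let a := adamState cfg.β₁ cfg.β₂ (cfg.generatorGrad s.1 s.2.2.1 z) s.2.2.2.1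
  let θ' := adamParam cfg.α cfg.β₁ cfg.β₂ cfg.κ s.2.2.1 a
  (s.1, s.2.1, θ', a, Function.update s.2.2.2.2 (k + 1) θ')

/-- Main-loop iteration number `k + 1`, from the state `s`. -/
def mainIteration (d : Fin n → E p) (k : ℕ) (s : State dw dθ) : Measure (State dw dθ) :=
  (cfg.criticLoop d cfg.nCritic s).bind fun s' =>
    (Measure.pi fun _ : Fin cfg.m => cfg.pz).map (cfg.generatorUpdate k s')

/-- The accountant's estimate of `δ` after `k` main-loop iterations; it has then been updated
`nCritic * k` times with the triple `(σ, m, dw)`. -/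
def accountedDelta (k : ℕ) : ℝ :=
  cfg.accountant (List.replicate (cfg.nCritic * k) (cfg.σ, cfg.m, dw)) cfg.ε₀

open Classical in
/-- The main loop from the state `s` reached after `k` iterations, for at most `t` further
iterations. It stops earlier when the convergence test succeeds or the budget is exceeded. -/
def mainLoop (d : Fin n → E p) : ℕ → ℕ → State dw dθ → Measure (State dw dθ)
  | 0, _, s => Measure.dirac s
  | t + 1, k, s =>
    if cfg.converged k s.2.2.2.2 then Measure.dirac s
    else (cfg.mainIteration d k s).bind fun s' =>
      if cfg.δ₀ < cfg.accountedDelta (k + 1) then Measure.dirac s'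
      else mainLoop d t (k + 1) s'

/-- The initial state. -/
def init : State dw dθ :=
  (cfg.w₀, adamInit dw, cfg.θ₀, adamInit dθ, Function.update (fun _ => 0) 0 cfg.θ₀)

/-- Law of the output (the parameters of the generator) of the training procedure on the database
`d`, when the main loop makes at most `t` iterations. -/
def output (t : ℕ) (d : Fin n → E p) : Measure (E dθ) :=
  (cfg.mainLoop d t 0 cfg.init).map fun s => s.2.2.1

end Config

end DPGAN

end

/-!
The privacy loss is controlled by moments of the likelihood ratio (the moments accountant), in the
dual form `HolderDominated p A μ ν`: `∫ f ∂μ ≤ A * (∫ f ^ p ∂ν) ^ (1 / p)` for all measurable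
`f ≥ 0`. If `r` is the exponent conjugate to `p`, this says that the `r`-th moment of `dμ/dν` under
`ν` is at most `A ^ r`. In this form post-processing is trivial, adaptive composition multiplies the
constants (`HolderDominated.bind`), and Young's inequality gives `(ε, δ)`-differential privacy as
soon as `A ^ r * exp (-(r - 1) ε) ≤ δ` (`HolderDominated.measure_le`).

One discriminator update. Let the two databases differ in entry `i`. The law of the seed does not
change when the selection bit of entry `i` and one noise vector are resampled
(`Config.measurePreserving_resample`). Given all other randomness, the update is the same function
of a subsampled Gaussian for both databases: `σ C` times a standard Gaussian vector plus, with
probability `q`, one of two vectors `v`, `v'` of length at most `1 / σ`. Further noise vectors are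
part of the shared randomness and can only help. With respect to the Gaussian measure the two laws have
the densities `P = 1 - q + q exp x` and `Q = 1 - q + q exp x'`, where `x` and `x'` are Gaussian of
size `1 / σ`. A Taylor expansion of `(P / Q) ^ r` at `1` loses its first-order term because `P` and
`Q` have the same mass, and the second-order term is `O(r² q² / σ²)`. The remainder is integrable
uniformly in `q`, `σ` and the dimension as long as `r - 2 ≤ σ² / 64`; this is the content of
`mixture_remainder_le` and `holderDominated_subsampledGaussian`.

The loops. By composition the output after at most `T = n_critic t` updates has an `r`-th moment of
at most `exp (O(T r² q² / σ²))`; generator updates are post-processing, and stopping early only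
helps. With `L = log (1 / δ)` and `e = q ε √T`, the bound on the noise scale gives
`T q² / σ² ≤ e² / (2 L)`.
An order `r` of size `L / e` then makes both the exponent and `r K e` multiples of `L`, and `K` is
chosen so large that the difference is at most `-L`. The two conditions on `e` say that this order
is bounded below (so that it can be rounded to an integer) and is at most a multiple of `σ²`
(so that the moment bound applies): `exists_order`.
-/

namespace DPGAN

open scoped ENNReal

/-! ### Hölder domination -/

section HolderDomination

variable {Ω Ω' : Type*} [MeasurableSpace Ω] [MeasurableSpace Ω']

/-- The dual form of a bound on the Rényi divergence of `μ` from `ν`: if `μ = h • ν` and `r` is the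
exponent conjugate to `p`, then the best constant `A` is the `L^r(ν)` norm of the density `h`, that
is, `A ^ r` is the `r`-th moment of `h`. No density occurs in the definition, so that mixtures,
images and adaptive compositions can be handled by Fubini alone. -/
def HolderDominated (p : ℝ) (A : ℝ≥0∞) (μ ν : Measure Ω) : Prop :=
  ∀ f : Ω → ℝ≥0∞, Measurable f → ∫⁻ x, f x ∂μ ≤ A * (∫⁻ x, f x ^ p ∂ν) ^ (1 / p)

namespace HolderDominated

variable {p : ℝ} {A B : ℝ≥0∞} {μ ν : Measure Ω}

lemma mono (h : HolderDominated p A μ ν) (hAB : A ≤ B) : HolderDominated p B μ ν :=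
  fun f hf => (h f hf).trans (by gcongr)

lemma refl (hp : 1 < p) (μ : Measure Ω) [IsProbabilityMeasure μ] : HolderDominated p 1 μ μ := by
  intro f hf
  have := ENNReal.lintegral_mul_le_Lp_mul_Lq μ (Real.HolderConjugate.conjExponent hp)
    hf.aemeasurable (aemeasurable_const (b := (1 : ℝ≥0∞)))
  simpa using this

lemma map (h : HolderDominated p A μ ν) {F : Ω → Ω'} (hF : Measurable F) :
    HolderDominated p A (μ.map F) (ν.map F) := by
  intro f hf
  rw [lintegral_map hf hF, lintegral_map (hf.pow_const p) hF]
  exact h _ (hf.comp hF)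

/-- Adaptive composition: the constants of the two steps multiply. -/
lemma bind (hp : 1 < p) (h : HolderDominated p A μ ν) {κ κ' : Ω → Measure Ω'}
    (hκ : Measurable κ) (hκ' : Measurable κ') (hB : ∀ x, HolderDominated p B (κ x) (κ' x)) :
    HolderDominated p (A * B) (μ.bind κ) (ν.bind κ') := by
  intro f hf
  have hp0 : p ≠ 0 := by positivity
  have hm : Measurable fun x => ∫⁻ y, f y ^ p ∂κ' x :=
    (Measure.measurable_lintegral (hf.pow_const p)).comp hκ'
  rw [Measure.lintegral_bind hκ.aemeasurable hf.aemeasurable,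
    Measure.lintegral_bind hκ'.aemeasurable (hf.pow_const p).aemeasurable]
  calc ∫⁻ x, ∫⁻ y, f y ∂κ x ∂μ
      ≤ ∫⁻ x, B * (∫⁻ y, f y ^ p ∂κ' x) ^ (1 / p) ∂μ := lintegral_mono fun x => hB x f hf
    _ = B * ∫⁻ x, (∫⁻ y, f y ^ p ∂κ' x) ^ (1 / p) ∂μ :=
        lintegral_const_mul _ (hm.pow_const _)
    _ ≤ B * (A * (∫⁻ x, ((∫⁻ y, f y ^ p ∂κ' x) ^ (1 / p)) ^ p ∂ν) ^ (1 / p)) := by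
        gcongr
        exact h _ (hm.pow_const _)
    _ = A * B * (∫⁻ x, ∫⁻ y, f y ^ p ∂κ' x ∂ν) ^ (1 / p) := by
        simp_rw [← ENNReal.rpow_mul, one_div_mul_cancel hp0, ENNReal.rpow_one]
        ring

/-- Hölder's inequality: a bound on the moment `∫ P ^ r Q ^ (1 - r)` gives Hölder domination. -/
lemma of_density {r : ℝ} (hpr : p.HolderConjugate r) {P Q : Ω → ℝ} (hP : Measurable P)
    (hQ : Measurable Q) (hP0 : ∀ x, 0 < P x) (hQ0 : ∀ x, 0 < Q x)
    (hB : ∫⁻ x, ENNReal.ofReal (P x ^ r * Q x ^ (1 - r)) ∂μ ≤ B) :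
    HolderDominated p (B ^ (1 / r)) (μ.withDensity fun x => ENNReal.ofReal (P x))
      (μ.withDensity fun x => ENNReal.ofReal (Q x)) := by
  intro f hf
  have hp0 := hpr.pos
  have hr0 := hpr.symm.pos
  have hrp : -(1 / p) * r = 1 - r := by
    have := hpr.inv_add_inv_eq_one
    field_simp at this ⊢
    linarith
  rw [lintegral_withDensity_eq_lintegral_mul _ hP.ennreal_ofReal hf,
    lintegral_withDensity_eq_lintegral_mul _ hQ.ennreal_ofReal (hf.pow_const p)]
  calc ∫⁻ x, ((fun x => ENNReal.ofReal (P x)) * f) x ∂μ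
      = ∫⁻ x, ((fun x => f x * ENNReal.ofReal (Q x ^ (1 / p))) *
          fun x => ENNReal.ofReal (P x * Q x ^ (-(1 / p)))) x ∂μ := by
        refine lintegral_congr fun x => ?_
        simp only [Pi.mul_apply]
        rw [mul_assoc, ← ENNReal.ofReal_mul (Real.rpow_nonneg (hQ0 x).le _), mul_left_comm,
          ← Real.rpow_add (hQ0 x), add_neg_cancel, Real.rpow_zero, mul_one, mul_comm]
    _ ≤ _ := ENNReal.lintegral_mul_le_Lp_mul_Lq μ hpr
        (hf.mul (hQ.pow_const _).ennreal_ofReal).aemeasurable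
        (hP.mul (hQ.pow_const _)).ennreal_ofReal.aemeasurable
    _ = (∫⁻ x, ((fun x => ENNReal.ofReal (Q x)) * fun x => f x ^ p) x ∂μ) ^ (1 / p) *
        (∫⁻ x, ENNReal.ofReal (P x ^ r * Q x ^ (1 - r)) ∂μ) ^ (1 / r) := by
        congr 2
        · refine lintegral_congr fun x => ?_
          simp only [Pi.mul_apply]
          rw [ENNReal.mul_rpow_of_nonneg _ _ hp0.le,
            ENNReal.ofReal_rpow_of_pos (Real.rpow_pos_of_pos (hQ0 x) _), ← Real.rpow_mul (hQ0 x).le,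
            one_div_mul_cancel hp0.ne', Real.rpow_one, mul_comm]
        · refine lintegral_congr fun x => ?_
          have := Real.rpow_pos_of_pos (hQ0 x) (-(1 / p))
          rw [ENNReal.ofReal_rpow_of_pos (mul_pos (hP0 x) this),
            Real.mul_rpow (hP0 x).le this.le, ← Real.rpow_mul (hQ0 x).le, hrp]
    _ ≤ _ := by
        rw [mul_comm]
        gcongr

/-- Conversion to approximate differential privacy, by Young's inequality. -/
lemma measure_le {r : ℝ} (hpr : p.HolderConjugate r) {M ε δ : ℝ}
    (h : HolderDominated p (ENNReal.ofReal (Real.exp (M / r))) μ ν)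
    (hδ : Real.exp (M - (r - 1) * ε) ≤ δ) {S : Set Ω} (hS : MeasurableSet S) :
    μ S ≤ ENNReal.ofReal (Real.exp ε) * ν S + ENNReal.ofReal δ := by
  have hp0 := hpr.pos
  have hr0 := hpr.symm.pos
  have hpr' : r / p = r - 1 := by
    have := hpr.inv_add_inv_eq_one
    field_simp at this ⊢
    linarith
  have h1 := h (S.indicator fun _ => 1) (measurable_const.indicator hS)
  have h2 : ∀ x, (S.indicator (fun _ => (1 : ℝ≥0∞)) x) ^ p = S.indicator (fun _ => 1) x := by
    intro x
    by_cases hx : x ∈ S <;> simp [hx, hp0]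
  simp_rw [h2, lintegral_indicator_const hS, one_mul] at h1
  have hexp : ENNReal.ofReal (Real.exp (M / r)) * ν S ^ (1 / p) =
      (ENNReal.ofReal (Real.exp ε) * ν S) ^ (1 / p) *
        ENNReal.ofReal (Real.exp ((M - (r - 1) * ε) / r)) := by
    rw [ENNReal.mul_rpow_of_nonneg _ _ (by positivity),
      ENNReal.ofReal_rpow_of_pos (Real.exp_pos _), mul_right_comm,
      ← ENNReal.ofReal_mul (by positivity), ← Real.exp_mul, ← Real.exp_add, ← hpr']
    congr 3
    field_simp
    ring
  calc μ S ≤ _ := h1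
    _ = _ := hexp
    _ ≤ _ := ENNReal.young_inequality _ _ hpr
    _ ≤ _ := by
      gcongr
      · rw [← ENNReal.rpow_mul, one_div_mul_cancel hp0.ne', ENNReal.rpow_one]
        refine ENNReal.div_le_of_le_mul (le_mul_of_one_le_right' ?_)
        exact ENNReal.one_le_ofReal.2 hpr.lt.le
      · rw [ENNReal.ofReal_rpow_of_pos (Real.exp_pos _), ← Real.exp_mul, div_mul_cancel₀ _ hr0.ne']
        refine ENNReal.div_le_of_le_mul ((ENNReal.ofReal_le_ofReal hδ).trans
          (le_mul_of_one_le_right' ?_))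
        exact ENNReal.one_le_ofReal.2 hpr.symm.lt.le

end HolderDominated

end HolderDomination

/-! ### Pointwise bounds for the likelihood ratio of two mixtures -/

section Pointwise

lemma pow_le_second_order {y : ℝ} (hy : 0 ≤ y) (k : ℕ) :
    y ^ (k + 2) ≤ 1 + (k + 2) * (y - 1) + (k + 2) ^ 2 * ((y - 1) ^ 2 * max 1 y ^ k) := by
  induction k with
  | zero => norm_num; nlinarith [sq_nonneg (y - 1)]
  | succ k ih =>
    set M := max 1 y
    have hM1 : (1 : ℝ) ≤ M ^ (k + 1) := one_le_pow₀ (le_max_left _ _)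
    have hM : y * M ^ k ≤ M ^ (k + 1) := by
      rw [pow_succ']
      gcongr
      exact le_max_right _ _
    have h1 := mul_le_mul_of_nonneg_left ih hy
    have h2 := mul_le_mul_of_nonneg_left hM (sq_nonneg (y - 1))
    have h3 := mul_le_mul_of_nonneg_left hM1 (sq_nonneg (y - 1))
    have h4 : 0 ≤ (y - 1) ^ 2 * M ^ (k + 1) := by positivity
    have hk : (0 : ℝ) ≤ k := k.cast_nonneg
    have h5 := mul_le_mul_of_nonneg_left h2 (sq_nonneg ((k : ℝ) + 2))
    have h6 := mul_le_mul_of_nonneg_left h3 (by positivity : (0 : ℝ) ≤ (k : ℝ) + 2)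
    have h7 := mul_nonneg hk h4
    push_cast
    rw [pow_succ' y (k + 2)]
    nlinarith

/-- The Taylor bound for the density of the divergence of order `k + 2`. The terms of first order
are kept on both sides, so that all terms are nonnegative and can be integrated as they are. -/
lemma pow_div_pow_add_le {P Q : ℝ} (hP : 0 < P) (hQ : 0 < Q) (k : ℕ) :
    P ^ (k + 2) / Q ^ (k + 1) + (k + 1) * Q ≤
      (k + 2) * P + (k + 2) ^ 2 * ((P - Q) ^ 2 / Q * max 1 (P / Q) ^ k) := by
  have h := mul_le_mul_of_nonneg_right (pow_le_second_order (div_pos hP hQ).le k) hQ.le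
  have e1 : (P / Q) ^ (k + 2) * Q = P ^ (k + 2) / Q ^ (k + 1) := by
    rw [div_pow, pow_succ Q (k + 1)]; field_simp
  have e2 : (P / Q - 1) ^ 2 * Q = (P - Q) ^ 2 / Q := by field_simp
  have e3 : (P / Q - 1) * Q = P - Q := by field_simp
  rw [e1] at h
  rw [← e2]
  linear_combination h + (k + 2) * e3

lemma one_sub_add_mul_exp_le {q : ℝ} (hq : 0 ≤ q) (hq1 : q ≤ 1) (x : ℝ) :
    1 - q + q * Real.exp x ≤ Real.exp (2 * q * |x| + x ^ 2) := by
  rcases le_total x 1 with hx | hx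
  · have h : Real.exp x - 1 ≤ 2 * |x| := by
      rcases le_total x 0 with h0 | h0
      · have := Real.exp_le_one_iff.2 h0
        linarith [abs_nonneg x]
      · have := Real.abs_exp_sub_one_le (x := x) (by rwa [abs_of_nonneg h0])
        exact (le_abs_self _).trans this
    calc 1 - q + q * Real.exp x ≤ 2 * q * |x| + 1 := by nlinarith
      _ ≤ Real.exp (2 * q * |x|) := Real.add_one_le_exp _
      _ ≤ _ := Real.exp_le_exp.2 (by nlinarith)
  · have h1 : (1 : ℝ) ≤ Real.exp x := Real.one_le_exp (by linarith)
    calc 1 - q + q * Real.exp x ≤ Real.exp x := by nlinarith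
      _ ≤ _ := Real.exp_le_exp.2 (by nlinarith [mul_nonneg hq (abs_nonneg x)])

lemma exp_mul_le_one_sub_add_mul_exp {q : ℝ} (hq : 0 ≤ q) (hq1 : q ≤ 1) (x : ℝ) :
    Real.exp (q * x) ≤ 1 - q + q * Real.exp x := by
  have := convexOn_exp.2 (Set.mem_univ 0) (Set.mem_univ x) (sub_nonneg.2 hq1) hq (by ring)
  simpa using this

lemma exp_sub_one_sq_le (x : ℝ) : (Real.exp x - 1) ^ 2 ≤ x ^ 2 * Real.exp (2 * |x|) := by
  have h : |Real.exp x - 1| ≤ |x| * Real.exp |x| := by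
    rcases le_total x 0 with h0 | h0
    · have h1 := Real.exp_le_one_iff.2 h0
      have h2 := Real.add_one_le_exp x
      have h3 : (1 : ℝ) ≤ Real.exp |x| := Real.one_le_exp (abs_nonneg x)
      rw [abs_of_nonpos (by linarith)]
      have : |x| = -x := abs_of_nonpos h0
      nlinarith [abs_nonneg x]
    · have h1 := Real.one_le_exp h0
      rw [abs_of_nonneg (by linarith), abs_of_nonneg h0]
      have h2 := Real.add_one_le_exp (-x)
      have h3 : Real.exp (-x) * Real.exp x = 1 := by rw [← Real.exp_add]; simp
      nlinarith [Real.exp_pos x]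
  calc (Real.exp x - 1) ^ 2 = |Real.exp x - 1| ^ 2 := (sq_abs _).symm
    _ ≤ (|x| * Real.exp |x|) ^ 2 := by gcongr
    _ = _ := by rw [mul_pow, sq_abs, ← Real.exp_nat_mul]; norm_num

/-- The squared relative deviation of a likelihood ratio `exp x` is of order `σ⁻²` up to a factor
that is integrable under the noise. -/
lemma exp_sub_one_sq_le_of_abs_le {σ x h : ℝ} (hσ : 1 ≤ σ) (hx : |x| ≤ (|h| + 1) / σ) :
    (Real.exp x - 1) ^ 2 ≤ 1 / σ ^ 2 * Real.exp (h ^ 2 / 16 + 68) := by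
  have hσ0 : 0 < σ := by linarith
  have hh := abs_nonneg h
  have hx1 : |x| ≤ |h| + 1 := hx.trans (div_le_self (by positivity) hσ)
  have hx2 : x ^ 2 ≤ ((|h| + 1) / σ) ^ 2 := by
    rw [← sq_abs]; gcongr
  have h1 : (|h| + 1) ^ 2 ≤ Real.exp (2 * (|h| + 1)) := by
    have : |h| + 1 ≤ Real.exp (|h| + 1) := by linarith [Real.add_one_le_exp (|h| + 1)]
    calc (|h| + 1) ^ 2 ≤ Real.exp (|h| + 1) ^ 2 := by gcongr
      _ = _ := by rw [← Real.exp_nat_mul]; norm_num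
  calc (Real.exp x - 1) ^ 2 ≤ x ^ 2 * Real.exp (2 * |x|) := exp_sub_one_sq_le x
    _ ≤ ((|h| + 1) / σ) ^ 2 * Real.exp (2 * (|h| + 1)) := by gcongr
    _ = 1 / σ ^ 2 * ((|h| + 1) ^ 2 * Real.exp (2 * (|h| + 1))) := by ring
    _ ≤ 1 / σ ^ 2 * (Real.exp (2 * (|h| + 1)) * Real.exp (2 * (|h| + 1))) := by gcongr
    _ ≤ _ := by
      rw [← Real.exp_add]
      refine mul_le_mul_of_nonneg_left (Real.exp_le_exp.2 ?_) (by positivity)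
      -- `4 (|h| + 1) ≤ h² / 16 + 68`, by completing the square
      nlinarith [sq_nonneg (|h| - 32), sq_abs h]

/-- The second-order remainder for the mixtures `1 - q + q exp x` and `1 - q + q exp x'`. Here `x`,
`x'` are log-likelihood ratios, and `h`, `h'` stand for Gaussian variables of variance at most `1`
that dominate them; `exp (h ^ 2 / 4)` is integrable under such a Gaussian. The bound
`k ≤ σ² / 64` on the order keeps the exponent below the Gaussian decay of the noise. -/
lemma mixture_remainder_le {q σ x x' h h' : ℝ} {k : ℕ} (hσ : 1 ≤ σ) (hq : 0 ≤ q)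
    (hqσ : q * σ ≤ 1 / 16) (hk : (k : ℝ) ≤ σ ^ 2 / 64) (hx : |x| ≤ (|h| + 1) / σ)
    (hx' : |x'| ≤ (|h'| + 1) / σ) {P Q : ℝ} (hP : P = 1 - q + q * Real.exp x)
    (hQ : Q = 1 - q + q * Real.exp x') :
    (P - Q) ^ 2 / Q * max 1 (P / Q) ^ k ≤
      4 * (q ^ 2 / σ ^ 2) * Real.exp 69 * (Real.exp (h ^ 2 / 4) + Real.exp (h' ^ 2 / 4)) := by
  have hσ0 : 0 < σ := by linarith
  have hq16 : q ≤ 1 / 16 := by nlinarith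
  have hq1 : q ≤ 1 := by linarith
  have hQ2 : 1 / 2 ≤ Q := by
    rw [hQ]; nlinarith [mul_nonneg hq (Real.exp_pos x').le]
  have hQ0 : 0 < Q := by linarith
  have hP0 : 0 < P := by
    rw [hP]; nlinarith [mul_nonneg hq (Real.exp_pos x).le]
  have hk0 : (0 : ℝ) ≤ k := k.cast_nonneg
  have hmax : max 1 (P / Q) ≤ Real.exp (2 * q * |x| + x ^ 2 + q * |x'|) := by
    refine max_le (Real.one_le_exp (by positivity)) ?_
    rw [div_le_iff₀ hQ0]
    calc P ≤ Real.exp (2 * q * |x| + x ^ 2) := hP ▸ one_sub_add_mul_exp_le hq hq1 x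
      _ ≤ Real.exp (2 * q * |x| + x ^ 2 + q * |x'|) * Real.exp (q * x') := by
        rw [← Real.exp_add]
        refine Real.exp_le_exp.2 ?_
        nlinarith [neg_abs_le x']
      _ ≤ _ := by
        gcongr
        exact hQ ▸ exp_mul_le_one_sub_add_mul_exp hq hq1 x'
  have hkq : k * q * (1 / σ) ≤ 1 / 1024 := by
    calc k * q * (1 / σ) ≤ (σ ^ 2 / 64) * q * (1 / σ) := by gcongr
      _ = q * σ / 64 := by field_simp
      _ ≤ _ := by linarith
  have b1 : k * q * |x| ≤ (|h| + 1) / 1024 := by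
    calc k * q * |x| ≤ k * q * ((|h| + 1) / σ) := by gcongr
      _ = k * q * (1 / σ) * (|h| + 1) := by ring
      _ ≤ 1 / 1024 * (|h| + 1) := by gcongr
      _ = _ := by ring
  have b1' : k * q * |x'| ≤ (|h'| + 1) / 1024 := by
    calc k * q * |x'| ≤ k * q * ((|h'| + 1) / σ) := by gcongr
      _ = k * q * (1 / σ) * (|h'| + 1) := by ring
      _ ≤ 1 / 1024 * (|h'| + 1) := by gcongr
      _ = _ := by ring
  have b2 : k * x ^ 2 ≤ (|h| + 1) ^ 2 / 64 := by
    calc k * x ^ 2 = k * |x| ^ 2 := by rw [sq_abs]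
      _ ≤ (σ ^ 2 / 64) * ((|h| + 1) / σ) ^ 2 := by gcongr
      _ = _ := by field_simp
  have hpow : max 1 (P / Q) ^ k ≤ Real.exp (h ^ 2 / 16 + h' ^ 2 / 16 + 1) := by
    calc max 1 (P / Q) ^ k ≤ Real.exp (2 * q * |x| + x ^ 2 + q * |x'|) ^ k := by gcongr
      _ = Real.exp (2 * (k * q * |x|) + k * x ^ 2 + k * q * |x'|) := by
        rw [← Real.exp_nat_mul]; ring_nf
      _ ≤ _ := by
        refine Real.exp_le_exp.2 ?_
        nlinarith [sq_nonneg (|h| - 1), sq_nonneg (|h'| - 1), sq_abs h, sq_abs h']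
  have hsq : (P - Q) ^ 2 ≤ 2 * q ^ 2 *
      (1 / σ ^ 2 * Real.exp (h ^ 2 / 16 + 68) + 1 / σ ^ 2 * Real.exp (h' ^ 2 / 16 + 68)) := by
    calc (P - Q) ^ 2 = q ^ 2 * ((Real.exp x - 1) - (Real.exp x' - 1)) ^ 2 := by rw [hP, hQ]; ring
      _ ≤ q ^ 2 * (2 * ((Real.exp x - 1) ^ 2 + (Real.exp x' - 1) ^ 2)) := by
        gcongr
        nlinarith [sq_nonneg ((Real.exp x - 1) + (Real.exp x' - 1))]
      _ = 2 * q ^ 2 * ((Real.exp x - 1) ^ 2 + (Real.exp x' - 1) ^ 2) := by ring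
      _ ≤ _ := by
        gcongr
        · exact exp_sub_one_sq_le_of_abs_le hσ hx
        · exact exp_sub_one_sq_le_of_abs_le hσ hx'
  set a := Real.exp (h ^ 2 / 8) with ha
  set a' := Real.exp (h' ^ 2 / 8) with ha'
  have ea : Real.exp (h ^ 2 / 4) = a ^ 2 := by rw [ha, ← Real.exp_nat_mul]; ring_nf
  have ea' : Real.exp (h' ^ 2 / 4) = a' ^ 2 := by rw [ha', ← Real.exp_nat_mul]; ring_nf
  have f1 : Real.exp (h ^ 2 / 16 + 68) * Real.exp (h ^ 2 / 16 + h' ^ 2 / 16 + 1) ≤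
      Real.exp 69 * (a * a') := by
    rw [ha, ha', ← Real.exp_add, ← Real.exp_add, ← Real.exp_add]
    refine Real.exp_le_exp.2 ?_
    linarith [sq_nonneg h']
  have f2 : Real.exp (h' ^ 2 / 16 + 68) * Real.exp (h ^ 2 / 16 + h' ^ 2 / 16 + 1) ≤
      Real.exp 69 * (a * a') := by
    rw [ha, ha', ← Real.exp_add, ← Real.exp_add, ← Real.exp_add]
    refine Real.exp_le_exp.2 ?_
    linarith [sq_nonneg h]
  calc (P - Q) ^ 2 / Q * max 1 (P / Q) ^ k
      ≤ (P - Q) ^ 2 / (1 / 2) * Real.exp (h ^ 2 / 16 + h' ^ 2 / 16 + 1) := by gcongr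
    _ ≤ (2 * q ^ 2 * (1 / σ ^ 2 * Real.exp (h ^ 2 / 16 + 68) +
          1 / σ ^ 2 * Real.exp (h' ^ 2 / 16 + 68))) / (1 / 2) *
          Real.exp (h ^ 2 / 16 + h' ^ 2 / 16 + 1) := by gcongr
    _ = 4 * (q ^ 2 / σ ^ 2) *
          (Real.exp (h ^ 2 / 16 + 68) * Real.exp (h ^ 2 / 16 + h' ^ 2 / 16 + 1) +
            Real.exp (h' ^ 2 / 16 + 68) * Real.exp (h ^ 2 / 16 + h' ^ 2 / 16 + 1)) := by ring
    _ ≤ 4 * (q ^ 2 / σ ^ 2) * (Real.exp 69 * (a * a') + Real.exp 69 * (a * a')) := by gcongr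
    _ = 4 * (q ^ 2 / σ ^ 2) * Real.exp 69 * (2 * a * a') := by ring
    _ ≤ _ := by
      rw [ea, ea']
      gcongr
      exact two_mul_le_add_sq a a'

end Pointwise

/-! ### Shifts and exponential moments of the standard Gaussian measure -/

section Gaussian

lemma gaussianReal_eq_withDensity (c : ℝ) :
    gaussianReal c 1 =
      (gaussianReal 0 1).withDensity fun x => ENNReal.ofReal (Real.exp (c * x - c ^ 2 / 2)) := by
  rw [gaussianReal_of_var_ne_zero _ one_ne_zero, gaussianReal_of_var_ne_zero _ one_ne_zero,
    ← withDensity_mul _ (measurable_gaussianPDF 0 1) (by fun_prop)]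
  congr 1
  ext x
  simp only [gaussianPDF, gaussianPDFReal, Pi.mul_apply]
  rw [← ENNReal.ofReal_mul (by positivity), mul_assoc _ (Real.exp _) (Real.exp _), ← Real.exp_add]
  congr 3
  simp
  ring

lemma pi_withDensity {ι : Type*} [Fintype ι] {X : ι → Type*} [∀ i, MeasurableSpace (X i)]
    (μ : ∀ i, Measure (X i)) [∀ i, IsProbabilityMeasure (μ i)] (f : ∀ i, X i → ℝ≥0∞)
    (hf : ∀ i, Measurable (f i)) [∀ i, SigmaFinite ((μ i).withDensity (f i))] :
    Measure.pi (fun i => (μ i).withDensity (f i)) =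
      (Measure.pi μ).withDensity fun x => ∏ i, f i (x i) := by
  refine Measure.pi_eq fun s hs => ?_
  rw [withDensity_apply _ (MeasurableSet.univ_pi hs), ← lintegral_indicator
    (MeasurableSet.univ_pi hs)]
  have h1 : ∀ x : ∀ i, X i, (Set.univ.pi s).indicator (fun x => ∏ i, f i (x i)) x =
      ∏ i, (s i).indicator (f i) (x i) := by
    intro x
    by_cases hx : x ∈ Set.univ.pi s
    · rw [Set.indicator_of_mem hx]
      exact Finset.prod_congr rfl fun i _ => (Set.indicator_of_mem (hx i trivial) _).symm
    · rw [Set.indicator_of_notMem hx]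
      obtain ⟨i, hi⟩ : ∃ i, x i ∉ s i := by simpa using hx
      exact (Finset.prod_eq_zero (Finset.mem_univ i) (Set.indicator_of_notMem hi _)).symm
  have hm : ∀ i, Measurable ((s i).indicator (f i)) := fun i => (hf i).indicator (hs i)
  simp_rw [h1]
  rw [lintegral_prod_eq_prod_lintegral_of_indepFun (μ := Measure.pi μ) Finset.univ
    (fun i (x : ∀ i, X i) => (s i).indicator (f i) (x i))
    (iIndepFun_pi fun i => (hm i).aemeasurable)
    fun i => (hm i).comp (measurable_pi_apply i)]
  refine Finset.prod_congr rfl fun i _ => ?_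
  rw [withDensity_apply _ (hs i), ← lintegral_indicator (hs i),
    ← (measurePreserving_eval μ i).lintegral_comp (hm i)]

variable {d : ℕ}

/-- The Cameron–Martin formula for the standard Gaussian measure. -/
lemma stdGaussian_map_const_add (v : E d) :
    (stdGaussian (E d)).map (fun x => v + x) = (stdGaussian (E d)).withDensity fun x =>
      ENNReal.ofReal (Real.exp (inner ℝ v x - ‖v‖ ^ 2 / 2)) := by
  have hm : Measurable (WithLp.toLp 2 : (Fin d → ℝ) → E d) := by fun_prop
  have key : (Measure.pi fun _ : Fin d => gaussianReal 0 1).map (fun x i => v i + x i) =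
      (Measure.pi fun _ : Fin d => gaussianReal 0 1).withDensity fun x =>
        ENNReal.ofReal (Real.exp (inner ℝ v (WithLp.toLp 2 x) - ‖v‖ ^ 2 / 2)) := by
    rw [Measure.pi_map_pi (fun i => by fun_prop)]
    have h1 : ∀ i, (gaussianReal 0 1).map (fun x => v i + x) = (gaussianReal 0 1).withDensity
        fun x => ENNReal.ofReal (Real.exp (v i * x - v i ^ 2 / 2)) := by
      intro i
      rw [gaussianReal_map_const_add, zero_add, gaussianReal_eq_withDensity]
    have : ∀ i, SigmaFinite ((gaussianReal 0 1).withDensity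
        fun x => ENNReal.ofReal (Real.exp (v i * x - v i ^ 2 / 2))) := by
      intro i
      rw [← gaussianReal_eq_withDensity]
      infer_instance
    simp_rw [h1]
    rw [pi_withDensity _ _ (fun i => by fun_prop)]
    congr 1
    ext x
    rw [← ENNReal.ofReal_prod_of_nonneg (fun i _ => (Real.exp_pos _).le), ← Real.exp_sum,
      Finset.sum_sub_distrib, EuclideanSpace.real_norm_sq_eq, Finset.sum_div]
    congr 3
    simp [PiLp.inner_apply, mul_comm]
  rw [← map_pi_eq_stdGaussian, Measure.map_map (by fun_prop) hm]
  have h2 : (fun x => v + x) ∘ (WithLp.toLp 2 : (Fin d → ℝ) → E d) =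
      WithLp.toLp 2 ∘ fun x i => v i + x i := rfl
  rw [h2, ← Measure.map_map hm (by fun_prop), key]
  ext s hs
  rw [Measure.map_apply hm hs, withDensity_apply _ (hm hs), withDensity_apply _ hs,
    setLIntegral_map hs (by fun_prop) hm]

lemma lintegral_exp_inner_sq_le (u : E d) (hu : ‖u‖ ≤ 1) :
    ∫⁻ x, ENNReal.ofReal (Real.exp ((inner ℝ u x) ^ 2 / 4)) ∂stdGaussian (E d) ≤
      ENNReal.ofReal 2 := by
  have h1 : (stdGaussian (E d)).map (fun x => inner ℝ u x) =
      (gaussianReal 0 1).map (fun x => ‖u‖ * x) := by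
    have := IsGaussian.map_eq_gaussianReal (μ := stdGaussian (E d)) (innerSL ℝ u)
    rw [integral_strongDual_stdGaussian, variance_dual_stdGaussian, innerSL_apply_norm] at this
    rw [gaussianReal_map_const_mul]
    simp only [mul_zero, mul_one]
    rwa [Real.toNNReal_of_nonneg (sq_nonneg _)] at this
  have h2 : Measurable fun y : ℝ => ENNReal.ofReal (Real.exp (y ^ 2 / 4)) := by fun_prop
  have hi : Integrable fun y : ℝ => (Real.sqrt (2 * Real.pi))⁻¹ * Real.exp (-(1 / 4) * y ^ 2) :=
    (integrable_exp_neg_mul_sq (by norm_num)).const_mul _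
  calc ∫⁻ x, ENNReal.ofReal (Real.exp ((inner ℝ u x) ^ 2 / 4)) ∂stdGaussian (E d)
      = ∫⁻ y, ENNReal.ofReal (Real.exp (y ^ 2 / 4)) ∂(gaussianReal 0 1).map (fun x => ‖u‖ * x) := by
        rw [← h1, lintegral_map h2 (by fun_prop)]
    _ = ∫⁻ y, ENNReal.ofReal (Real.exp ((‖u‖ * y) ^ 2 / 4)) ∂gaussianReal 0 1 :=
        lintegral_map h2 (by fun_prop)
    _ ≤ ∫⁻ y, ENNReal.ofReal (Real.exp (y ^ 2 / 4)) ∂gaussianReal 0 1 := by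
        refine lintegral_mono fun y => ?_
        gcongr ENNReal.ofReal (Real.exp (?_ / 4))
        rw [mul_pow]
        exact mul_le_of_le_one_left (sq_nonneg y) (pow_le_one₀ (norm_nonneg u) hu)
    _ = ∫⁻ y : ℝ, ENNReal.ofReal ((Real.sqrt (2 * Real.pi))⁻¹ * Real.exp (-(1 / 4) * y ^ 2)) := by
        rw [gaussianReal_of_var_ne_zero _ one_ne_zero,
          lintegral_withDensity_eq_lintegral_mul _ (measurable_gaussianPDF 0 1) h2]
        refine lintegral_congr fun y => ?_
        simp only [gaussianPDF, gaussianPDFReal, Pi.mul_apply]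
        rw [← ENNReal.ofReal_mul (by positivity), mul_assoc, ← Real.exp_add]
        congr 2
        · simp
        · congr 1
          simp
          ring
    _ = ENNReal.ofReal ((Real.sqrt (2 * Real.pi))⁻¹ * Real.sqrt (Real.pi / (1 / 4))) := by
        rw [← ofReal_integral_eq_lintegral_ofReal hi (ae_of_all _ fun y => by positivity),
          integral_const_mul, integral_gaussian]
    _ ≤ ENNReal.ofReal 2 := by
        refine ENNReal.ofReal_le_ofReal ?_
        rw [inv_mul_le_iff₀ (by positivity), mul_comm,
          show (2 : ℝ) = Real.sqrt (2 ^ 2) by rw [Real.sqrt_sq]; norm_num,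
          ← Real.sqrt_mul (by positivity)]
        refine Real.sqrt_le_sqrt ?_
        rw [Real.sqrt_sq (by norm_num)]
        linarith [Real.pi_pos]

end Gaussian

/-! ### Moments of the subsampled Gaussian -/

section SubsampledGaussian

variable {d : ℕ}

/-- The subsampled Gaussian mechanism with unit noise: the vector `v` is present with probability
`q`, and standard Gaussian noise is added. -/
noncomputable def subsampledGaussian (q : unitInterval) (v : E d) : Measure (E d) :=
  ((bernoulliMeasure true false q).prod (stdGaussian (E d))).map
    fun u => (if u.1 = true then v else 0) + u.2

lemma measurable_select_add (v : E d) :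
    Measurable fun u : Bool × E d => (if u.1 = true then v else 0) + u.2 := by
  refine Measurable.add (Measurable.ite ?_ measurable_const measurable_const) measurable_snd
  exact measurable_fst (measurableSet_singleton true)

/-- Density of `subsampledGaussian q v` with respect to the standard Gaussian measure. -/
noncomputable def mixtureDensity (q : ℝ) (v x : E d) : ℝ :=
  1 - q + q * Real.exp (inner ℝ v x - ‖v‖ ^ 2 / 2)

lemma measurable_mixtureDensity (q : ℝ) (v : E d) : Measurable (mixtureDensity q v) := by
  unfold mixtureDensity
  fun_prop

lemma mixtureDensity_pos {q : ℝ} (hq0 : 0 ≤ q) (hq1 : q < 1) (v x : E d) :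
    0 < mixtureDensity q v x := by
  unfold mixtureDensity
  have := mul_nonneg hq0 (Real.exp_pos (inner ℝ v x - ‖v‖ ^ 2 / 2)).le
  linarith

lemma subsampledGaussian_eq_withDensity (q : unitInterval) (v : E d) :
    subsampledGaussian q v = (stdGaussian (E d)).withDensity fun x =>
      ENNReal.ofReal (mixtureDensity q v x) := by
  have hm := measurable_select_add v
  have h0 : (0 : ℝ) ≤ q := q.2.1
  have h1 : (0 : ℝ) ≤ 1 - q := sub_nonneg.2 q.2.2
  refine Measure.ext_of_lintegral _ fun f hf => ?_
  have e : ∫⁻ x, f (v + x) ∂stdGaussian (E d) = ∫⁻ x,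
      ENNReal.ofReal (Real.exp (inner ℝ v x - ‖v‖ ^ 2 / 2)) * f x ∂stdGaussian (E d) := by
    rw [← lintegral_map hf (measurable_const_add v), stdGaussian_map_const_add,
      lintegral_withDensity_eq_lintegral_mul _ (by fun_prop) hf]
    rfl
  rw [subsampledGaussian, lintegral_map hf hm,
    lintegral_prod (fun u : Bool × E d => f ((if u.1 = true then v else 0) + u.2))
      (hf.comp hm).aemeasurable,
    bernoulliMeasure_def, lintegral_add_measure, lintegral_smul_measure, lintegral_smul_measure,
    lintegral_dirac, lintegral_dirac,
    lintegral_withDensity_eq_lintegral_mul _ (measurable_mixtureDensity _ v).ennreal_ofReal hf]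
  simp only [if_true, Bool.false_eq_true, if_false, zero_add, Pi.mul_apply]
  have e2 : ∀ x, ENNReal.ofReal (mixtureDensity q v x) * f x =
      ENNReal.ofReal q * (ENNReal.ofReal (Real.exp (inner ℝ v x - ‖v‖ ^ 2 / 2)) * f x) +
        ENNReal.ofReal (1 - q) * f x := by
    intro x
    rw [mixtureDensity, add_comm, ENNReal.ofReal_add (by positivity) h1, ENNReal.ofReal_mul h0]
    ring
  simp_rw [e2]
  rw [lintegral_add_right _ (by fun_prop), lintegral_const_mul _ (by fun_prop),
    lintegral_const_mul _ hf, e]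
  congr 2
  · exact (Real.toNNReal_of_nonneg h0).symm
  · exact (Real.toNNReal_of_nonneg h1).symm

lemma lintegral_mixtureDensity (q : unitInterval) (v : E d) :
    ∫⁻ x, ENNReal.ofReal (mixtureDensity q v x) ∂stdGaussian (E d) = 1 := by
  have hm := measurable_select_add v
  have : IsProbabilityMeasure (subsampledGaussian q v) :=
    Measure.isProbabilityMeasure_map hm.aemeasurable
  have h := measure_univ (μ := subsampledGaussian q v)
  rwa [subsampledGaussian_eq_withDensity, withDensity_apply _ MeasurableSet.univ,
    Measure.restrict_univ] at h

lemma abs_log_likelihood_le {σ : ℝ} (hσ : 1 ≤ σ) {v : E d} (hv : ‖v‖ ≤ 1 / σ) (x : E d) :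
    |inner ℝ v x - ‖v‖ ^ 2 / 2| ≤ (|inner ℝ (σ • v) x| + 1) / σ := by
  have hσ0 : 0 < σ := by linarith
  have h1 : |inner ℝ (σ • v) x| = σ * |inner ℝ v x| := by
    rw [real_inner_smul_left, abs_mul, abs_of_pos hσ0]
  have h2 : 1 / σ ≤ 1 := by rw [div_le_one hσ0]; exact hσ
  have h3 : ‖v‖ ^ 2 / 2 ≤ 1 / σ := by nlinarith [norm_nonneg v]
  have h4 : (|inner ℝ (σ • v) x| + 1) / σ = |inner ℝ v x| + 1 / σ := by
    rw [h1]; field_simp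
  rw [h4]
  calc |inner ℝ v x - ‖v‖ ^ 2 / 2| ≤ |inner ℝ v x| + |‖v‖ ^ 2 / 2| := abs_sub _ _
    _ ≤ _ := by
      rw [abs_of_nonneg (by positivity : (0 : ℝ) ≤ ‖v‖ ^ 2 / 2)]
      gcongr

/-- The absolute constant in the moment bound for the subsampled Gaussian mechanism. -/
noncomputable def momentConst : ℝ := 16 * Real.exp 69

lemma momentConst_pos : 0 < momentConst := by unfold momentConst; positivity

variable {q : unitInterval} {σ : ℝ} {k : ℕ} {v v' : E d}

/-- The moments of the likelihood ratio of two subsampled Gaussian mechanisms with sampling rate `q`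
and sensitivity `1 / σ` deviate from `1` by `O(q² / σ²)`: the first-order terms integrate to the
same mass on both sides, and the remainder is integrable uniformly in the order. -/
lemma lintegral_mixtureDensity_moment_le (hσ : 1 ≤ σ) (hqσ : q * σ ≤ 1 / 16)
    (hk : (k : ℝ) ≤ σ ^ 2 / 64) (hv : ‖v‖ ≤ 1 / σ) (hv' : ‖v'‖ ≤ 1 / σ) :
    ∫⁻ x, ENNReal.ofReal (mixtureDensity q v x ^ (k + 2) / mixtureDensity q v' x ^ (k + 1))
        ∂stdGaussian (E d) ≤
      ENNReal.ofReal (1 + momentConst * (k + 2) ^ 2 * (q ^ 2 / σ ^ 2)) := by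
  have hσ0 : 0 < σ := by linarith
  have hq0 : (0 : ℝ) ≤ q := q.2.1
  have hq1 : (q : ℝ) < 1 := by nlinarith
  have hpos := mixtureDensity_pos (d := d) hq0 hq1
  have hm := measurable_mixtureDensity (d := d) q
  have hmono : ∀ w : E d, ‖w‖ ≤ 1 / σ → ‖σ • w‖ ≤ 1 := fun w hw => by
    rw [norm_smul, Real.norm_of_nonneg hσ0.le, mul_comm]
    exact (le_div_iff₀ hσ0).1 hw
  set c : ℝ := (k + 2) ^ 2 * (4 * (q ^ 2 / σ ^ 2) * Real.exp 69) with hc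
  have hc0 : 0 ≤ c := by positivity
  have hpt : ∀ x,
      ENNReal.ofReal (mixtureDensity q v x ^ (k + 2) / mixtureDensity q v' x ^ (k + 1)) +
      ENNReal.ofReal (k + 1) * ENNReal.ofReal (mixtureDensity q v' x) ≤
      ENNReal.ofReal (k + 2) * ENNReal.ofReal (mixtureDensity q v x) + ENNReal.ofReal c *
        (ENNReal.ofReal (Real.exp (inner ℝ (σ • v) x ^ 2 / 4)) +
          ENNReal.ofReal (Real.exp (inner ℝ (σ • v') x ^ 2 / 4))) := by
    intro x
    have hP := hpos v x
    have hQ := hpos v' x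
    rw [← ENNReal.ofReal_mul (by positivity), ← ENNReal.ofReal_mul (by positivity),
      ← ENNReal.ofReal_add (by positivity) (by positivity),
      ← ENNReal.ofReal_add (by positivity) (by positivity),
      ← ENNReal.ofReal_mul hc0, ← ENNReal.ofReal_add (by positivity) (by positivity)]
    refine ENNReal.ofReal_le_ofReal ((pow_div_pow_add_le hP hQ k).trans ?_)
    rw [hc, mul_assoc (_ ^ 2)]
    refine add_le_add_right (mul_le_mul_of_nonneg_left ?_ (by positivity)) _
    exact mixture_remainder_le hσ hq0 hqσ hk (abs_log_likelihood_le hσ hv x)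
      (abs_log_likelihood_le hσ hv' x) rfl rfl
  have hint := lintegral_mono (μ := stdGaussian (E d)) hpt
  rw [lintegral_add_right _ (by fun_prop), lintegral_add_right _ (by fun_prop),
    lintegral_const_mul _ (by fun_prop), lintegral_const_mul _ (by fun_prop),
    lintegral_const_mul _ (by fun_prop), lintegral_add_right _ (by fun_prop),
    lintegral_mixtureDensity, lintegral_mixtureDensity, mul_one, mul_one] at hint
  refine ENNReal.le_of_add_le_add_right (ENNReal.ofReal_ne_top (r := (k : ℝ) + 1)) (hint.trans ?_)
  calc _ ≤ ENNReal.ofReal (k + 2) + ENNReal.ofReal c * (ENNReal.ofReal 2 + ENNReal.ofReal 2) := by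
        gcongr
        · exact lintegral_exp_inner_sq_le _ (hmono v hv)
        · exact lintegral_exp_inner_sq_le _ (hmono v' hv')
    _ = _ := by
        have hm0 := momentConst_pos
        rw [← ENNReal.ofReal_add (by norm_num) (by norm_num), ← ENNReal.ofReal_mul hc0,
          ← ENNReal.ofReal_add (by positivity) (by positivity),
          ← ENNReal.ofReal_add (by positivity) (by positivity), hc, momentConst]
        congr 1
        ring

/-- The subsampled Gaussian mechanism under replacement of the sampled vector. -/
lemma holderDominated_subsampledGaussian {p : ℝ} (hp : p.HolderConjugate (k + 2)) (hσ : 1 ≤ σ)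
    (hqσ : q * σ ≤ 1 / 16) (hk : (k : ℝ) ≤ σ ^ 2 / 64) (hv : ‖v‖ ≤ 1 / σ) (hv' : ‖v'‖ ≤ 1 / σ) :
    HolderDominated p
      (ENNReal.ofReal (Real.exp (momentConst * (k + 2) ^ 2 * (q ^ 2 / σ ^ 2) / (k + 2))))
      (subsampledGaussian q v) (subsampledGaussian q v') := by
  have hq0 : (0 : ℝ) ≤ q := q.2.1
  have hq1 : (q : ℝ) < 1 := by nlinarith
  have hpos := mixtureDensity_pos (d := d) hq0 hq1
  rw [subsampledGaussian_eq_withDensity, subsampledGaussian_eq_withDensity]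
  refine (HolderDominated.of_density hp (measurable_mixtureDensity _ _)
    (measurable_mixtureDensity _ _) (hpos v) (hpos v')
    (B := ENNReal.ofReal (Real.exp (momentConst * (k + 2) ^ 2 * (q ^ 2 / σ ^ 2)))) ?_).mono ?_
  · refine le_trans (le_of_eq ?_) ((lintegral_mixtureDensity_moment_le hσ hqσ hk hv hv').trans ?_)
    · refine lintegral_congr fun x => ?_
      have e1 : mixtureDensity q v x ^ ((k : ℝ) + 2) = mixtureDensity q v x ^ (k + 2) := by
        exact_mod_cast Real.rpow_natCast (mixtureDensity q v x) (k + 2)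
      have e2 : mixtureDensity q v' x ^ (1 - ((k : ℝ) + 2)) =
          (mixtureDensity q v' x ^ (k + 1))⁻¹ := by
        rw [← Real.rpow_natCast, ← Real.rpow_neg (hpos v' x).le]
        congr 1
        push_cast
        ring
      rw [e1, e2, div_eq_mul_inv]
    · refine ENNReal.ofReal_le_ofReal ?_
      rw [add_comm]
      exact Real.add_one_le_exp _
  · rw [ENNReal.ofReal_rpow_of_pos (Real.exp_pos _), ← Real.exp_mul, mul_one_div]

end SubsampledGaussian

/-! ### Resampling coordinates of product measures -/

section Resampling

lemma measurable_map_prodMk {X Y W : Type*} [MeasurableSpace X] [MeasurableSpace Y]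
    [MeasurableSpace W] (ν : Measure Y) [SFinite ν] {F : X × Y → W} (hF : Measurable F) :
    Measurable fun x => ν.map fun y => F (x, y) := by
  refine Measure.measurable_of_measurable_coe _ fun s hs => ?_
  have h : ∀ x, (ν.map fun y => F (x, y)) s = ν (Prod.mk x ⁻¹' (F ⁻¹' s)) := fun x => by
    have hFx : Measurable fun y => F (x, y) := hF.comp measurable_prodMk_left
    rw [Measure.map_apply hFx hs]
    rfl
  simp_rw [h]
  exact measurable_measure_prodMk_left (hF hs)

lemma map_prod_eq_bind {X Y W : Type*} [MeasurableSpace X] [MeasurableSpace Y]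
    [MeasurableSpace W] (μ : Measure X) (ν : Measure Y) [SFinite ν] {F : X × Y → W}
    (hF : Measurable F) : (μ.prod ν).map F = μ.bind fun x => ν.map fun y => F (x, y) := by
  refine Measure.ext_of_lintegral _ fun f hf => ?_
  rw [lintegral_map hf hF, lintegral_prod (fun u => f (F u)) (hf.comp hF).aemeasurable,
    Measure.lintegral_bind (measurable_map_prodMk ν hF).aemeasurable hf.aemeasurable]
  refine lintegral_congr fun x => ?_
  have hFx : Measurable fun y => F (x, y) := hF.comp measurable_prodMk_left
  rw [lintegral_map hf hFx]

/-- Resampling one coordinate of a product probability measure does not change its law. -/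
lemma measurePreserving_update {ι : Type*} [Fintype ι] [DecidableEq ι] {X : ι → Type*}
    [∀ i, MeasurableSpace (X i)] (μ : ∀ i, Measure (X i)) [∀ i, IsProbabilityMeasure (μ i)]
    (i : ι) : MeasurePreserving (fun u : (∀ i, X i) × X i => Function.update u.1 i u.2)
      ((Measure.pi μ).prod (μ i)) (Measure.pi μ) := by
  have hm : Measurable fun u : (∀ i, X i) × X i => Function.update u.1 i u.2 :=
    measurable_update'
  refine ⟨hm, (Measure.pi_eq fun s hs => ?_).symm⟩
  have e : (fun u : (∀ i, X i) × X i => Function.update u.1 i u.2) ⁻¹' Set.univ.pi s =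
      (Set.univ.pi (Function.update s i Set.univ)) ×ˢ s i := by
    ext u
    simp only [Set.mem_preimage, Set.mem_univ_pi, Set.mem_prod]
    constructor
    · refine fun h => ⟨fun j => ?_, by simpa using h i⟩
      by_cases hj : j = i
      · subst hj; simp
      · simpa [hj] using h j
    · rintro ⟨h, h'⟩ j
      by_cases hj : j = i
      · subst hj; simpa using h'
      · simpa [hj] using h j
  rw [Measure.map_apply hm (MeasurableSet.univ_pi hs), e, Measure.prod_prod, Measure.pi_pi,
    ← Finset.mul_prod_erase Finset.univ _ (Finset.mem_univ i),
    ← Finset.mul_prod_erase Finset.univ (fun j => μ j (s j)) (Finset.mem_univ i)]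
  rw [Function.update_self, measure_univ, one_mul, mul_comm]
  congr 1
  refine Finset.prod_congr rfl fun j hj => ?_
  rw [Function.update_of_ne (Finset.ne_of_mem_erase hj)]

variable {X Y W : Type*} [MeasurableSpace X] [MeasurableSpace Y] [MeasurableSpace W]
  {μ : Measure X} {ν : Measure Y} {κ : Measure W} [SFinite μ] [SFinite ν] [SFinite κ]

lemma measurePreserving_resample_snd {g : X × W → X}
    (hg : MeasurePreserving g (μ.prod κ) μ) :
    MeasurePreserving (fun u : (Y × X) × W => (u.1.1, g (u.1.2, u.2)))
      ((ν.prod μ).prod κ) (ν.prod μ) :=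
  ((MeasurePreserving.id ν).prod hg).comp (measurePreserving_prodAssoc ν μ κ)

lemma measurePreserving_resample_fst {g : X × W → X}
    (hg : MeasurePreserving g (μ.prod κ) μ) :
    MeasurePreserving (fun u : (X × Y) × W => (g (u.1.1, u.2), u.1.2))
      ((μ.prod ν).prod κ) (μ.prod ν) :=
  (Measure.measurePreserving_swap (μ := ν) (ν := μ)).comp
    ((measurePreserving_resample_snd hg).comp
      ((Measure.measurePreserving_swap (μ := μ) (ν := ν)).prod (MeasurePreserving.id κ)))

end Resampling

/-! ### Measurability of the training procedure -/

section Measurability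

variable {d : ℕ}

lemma measurable_adamState (β₁ β₂ : ℝ) :
    Measurable fun u : E d × AdamState d => adamState β₁ β₂ u.1 u.2 := by
  unfold adamState
  refine Measurable.prodMk (by fun_prop) (Measurable.prodMk ?_ (by fun_prop))
  refine (by fun_prop : Measurable (WithLp.toLp 2 : (Fin d → ℝ) → E d)).comp ?_
  fun_prop

lemma measurable_adamParam (α β₁ β₂ κ : ℝ) :
    Measurable fun u : E d × AdamState d => adamParam α β₁ β₂ κ u.1 u.2 := by
  unfold adamParam
  refine (by fun_prop : Measurable (WithLp.toLp 2 : (Fin d → ℝ) → E d)).comp ?_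
  have h : ∀ β : ℝ, Measurable fun u : E d × AdamState d => β ^ u.2.2.2 := fun β =>
    (measurable_from_nat (f := fun n : ℕ => β ^ n)).comp
      (measurable_snd.comp (measurable_snd.comp measurable_snd))
  have h1 := h β₁
  have h2 := h β₂
  fun_prop

lemma measurable_clip (C : ℝ) : Measurable (clip C : E d → E d) := by
  unfold clip
  fun_prop

lemma norm_clip_le {C : ℝ} (hC : 0 < C) (g : E d) : ‖clip C g‖ ≤ C := by
  have h1 : 0 < max 1 (‖g‖ / C) := lt_max_of_lt_left one_pos
  rw [clip, norm_smul, norm_inv, Real.norm_of_nonneg h1.le, inv_mul_le_iff₀ h1]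
  exact (div_le_iff₀ hC).1 (le_max_right _ _)

end Measurability

namespace Config

variable {p dw dθ n : ℕ} {Z : Type*} [MeasurableSpace Z] (cfg : Config p dw dθ Z)

/-- The update of the discriminator's state with a given gradient. -/
noncomputable def criticStep (s : State dw dθ) (g : E dw) : State dw dθ :=
  let a := adamState cfg.β₁ cfg.β₂ g s.2.1
  (adamParam cfg.α cfg.β₁ cfg.β₂ cfg.κ s.1 a, a, s.2.2)

lemma measurable_criticStep :
    Measurable fun u : State dw dθ × E dw => cfg.criticStep u.1 u.2 := by
  have ha : Measurable fun u : State dw dθ × E dw =>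
      adamState cfg.β₁ cfg.β₂ u.2 u.1.2.1 :=
    (measurable_adamState cfg.β₁ cfg.β₂).comp (by fun_prop : Measurable
      fun u : State dw dθ × E dw => (u.2, u.1.2.1))
  have hw := (measurable_adamParam cfg.α cfg.β₁ cfg.β₂ cfg.κ).comp
    ((measurable_fst.comp measurable_fst).prodMk ha)
  exact hw.prodMk (ha.prodMk (by fun_prop))

/-- Measurability of the data of the training procedure, as far as the laws depend on it. -/
structure IsMeasurable : Prop where
  /-- the gradient of the loss of each fixed sample is jointly measurable -/
  sampleGrad : ∀ x : E p, Measurable fun u : E dw × E dθ × Z × ℝ =>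
    cfg.sampleGrad x u.1 u.2.1 u.2.2.1 u.2.2.2
  /-- the gradient of the generator's loss is jointly measurable -/
  generatorGrad : Measurable fun u : E dw × E dθ × (Fin cfg.m → Z) =>
    cfg.generatorGrad u.1 u.2.1 u.2.2
  /-- the convergence test is measurable in the history -/
  converged : ∀ k : ℕ, MeasurableSet {h : ℕ → E dθ | cfg.converged k h}

variable {cfg}

lemma measurable_criticUpdate (hcfg : cfg.IsMeasurable) (d : Fin n → E p) :
    Measurable fun u : State dw dθ × cfg.CriticSeed n => cfg.criticUpdate d u.1 u.2 := by
  have hsample : ∀ i, Measurable fun u : State dw dθ × cfg.CriticSeed n =>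
      cfg.sampleGrad (d i) u.1.1 u.1.2.2.1 (u.2.2.1 i) (u.2.2.2.1 i) := fun i => by
    have ht : Measurable fun u : State dw dθ × cfg.CriticSeed n =>
        ((u.1.1, u.1.2.2.1, u.2.2.1 i, u.2.2.2.1 i) : E dw × E dθ × Z × ℝ) := by
      fun_prop
    simpa only [Function.comp_def] using (hcfg.sampleGrad (d i)).comp ht
  have hbit : ∀ i, MeasurableSet {u : State dw dθ × cfg.CriticSeed n | u.2.1 i = true} :=
    fun i => by
      have ht : Measurable fun u : State dw dθ × cfg.CriticSeed n => u.2.1 i := by fun_prop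
      exact ht (measurableSet_singleton true)
  have hsum : Measurable fun u : State dw dθ × cfg.CriticSeed n => ∑ i,
      if u.2.1 i = true then clip cfg.C (cfg.sampleGrad (d i) u.1.1 u.1.2.2.1 (u.2.2.1 i)
        (u.2.2.2.1 i)) else 0 :=
    Finset.measurable_sum _ fun i _ => Measurable.ite (hbit i)
      ((measurable_clip _).comp (hsample i)) measurable_const
  have hnoise : Measurable fun u : State dw dθ × cfg.CriticSeed n => ∑ j, u.2.2.2.2 j := by
    fun_prop
  have hb : Measurable fun u : State dw dθ × cfg.CriticSeed n =>
      cfg.batchGrad d u.1.1 u.1.2.2.1 u.2 := 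
    (hsum.add hnoise).const_smul (1 / (cfg.m : ℝ))
  exact cfg.measurable_criticStep.comp (measurable_fst.prodMk hb)

lemma measurable_generatorUpdate (hcfg : cfg.IsMeasurable) (k : ℕ) :
    Measurable fun u : State dw dθ × (Fin cfg.m → Z) => cfg.generatorUpdate k u.1 u.2 := by
  have ha : Measurable fun u : State dw dθ × (Fin cfg.m → Z) =>
      adamState cfg.β₁ cfg.β₂ (cfg.generatorGrad u.1.1 u.1.2.2.1 u.2) u.1.2.2.2.1 :=
    (measurable_adamState cfg.β₁ cfg.β₂).comp ((hcfg.generatorGrad.comp (by fun_prop : Measurable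
      fun u : State dw dθ × (Fin cfg.m → Z) => (u.1.1, u.1.2.2.1, u.2))).prodMk (by fun_prop))
  have hθ : Measurable fun u : State dw dθ × (Fin cfg.m → Z) =>
      adamParam cfg.α cfg.β₁ cfg.β₂ cfg.κ u.1.2.2.1
        (adamState cfg.β₁ cfg.β₂ (cfg.generatorGrad u.1.1 u.1.2.2.1 u.2) u.1.2.2.2.1) :=
    (measurable_adamParam _ _ _ _).comp (Measurable.prodMk (by fun_prop) ha)
  refine Measurable.prodMk (by fun_prop) (Measurable.prodMk (by fun_prop)
    (hθ.prodMk (ha.prodMk ?_)))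
  have hu : Measurable fun u : (ℕ → E dθ) × E dθ => Function.update u.1 (k + 1) u.2 :=
    measurable_update'
  exact hu.comp (Measurable.prodMk (by fun_prop) hθ)

/-! ### Composition over the training procedure -/

variable (cfg) [IsProbabilityMeasure cfg.pz]

instance isProbabilityMeasure_criticSeedLaw (n : ℕ) :
    IsProbabilityMeasure (cfg.criticSeedLaw n) := by
  have h1 : IsProbabilityMeasure ((volume : Measure ℝ).restrict (Set.Icc 0 1)) :=
    ⟨by simp⟩
  have h2 : IsProbabilityMeasure ((stdGaussian (E dw)).map fun ξ => (cfg.σ * cfg.C) • ξ) :=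
    Measure.isProbabilityMeasure_map (by fun_prop)
  unfold criticSeedLaw
  infer_instance

/-- The sampling rate `m / n`, cut off at `1`. -/
noncomputable def samplingRate (n : ℕ) : unitInterval :=
  Set.projIcc (0 : ℝ) 1 zero_le_one ((cfg.m : ℝ) / n)

/-- Replaces the selection bit of entry `i` and the noise vector with index `j`. -/
noncomputable def resample (i : Fin n) (j : Fin cfg.r) (u : cfg.CriticSeed n × Bool × E dw) :
    cfg.CriticSeed n :=
  (Function.update u.1.1 i u.2.1, u.1.2.1, u.1.2.2.1,
    Function.update u.1.2.2.2 j ((cfg.σ * cfg.C) • u.2.2))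

lemma measurePreserving_resample (i : Fin n) (j : Fin cfg.r) :
    MeasurePreserving (cfg.resample i j)
      ((cfg.criticSeedLaw n).prod
        ((bernoulliMeasure true false (cfg.samplingRate n)).prod (stdGaussian (E dw))))
      (cfg.criticSeedLaw n) := by
  have h1 : IsProbabilityMeasure ((volume : Measure ℝ).restrict (Set.Icc 0 1)) :=
    ⟨by simp⟩
  have h2 : IsProbabilityMeasure ((stdGaussian (E dw)).map fun ξ => (cfg.σ * cfg.C) • ξ) :=
    Measure.isProbabilityMeasure_map (by fun_prop)
  have hsm : MeasurePreserving (fun ξ : E dw => (cfg.σ * cfg.C) • ξ) (stdGaussian (E dw))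
      ((stdGaussian (E dw)).map fun ξ => (cfg.σ * cfg.C) • ξ) := ⟨by fun_prop, rfl⟩
  have hbit := measurePreserving_update (fun _ : Fin n =>
    bernoulliMeasure true false (cfg.samplingRate n)) i
  have hnoise := (measurePreserving_update (fun _ : Fin cfg.r =>
    (stdGaussian (E dw)).map fun ξ => (cfg.σ * cfg.C) • ξ) j).comp
      ((MeasurePreserving.id _).prod hsm)
  have hb := measurePreserving_resample_fst (ν := (Measure.pi fun _ : Fin n => cfg.pz).prod
      ((Measure.pi fun _ : Fin n => (volume : Measure ℝ).restrict (Set.Icc 0 1)).prod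
        (Measure.pi fun _ : Fin cfg.r =>
          (stdGaussian (E dw)).map fun ξ => (cfg.σ * cfg.C) • ξ))) hbit
  have hn := measurePreserving_resample_snd
    (ν := Measure.pi fun _ : Fin n => bernoulliMeasure true false (cfg.samplingRate n))
    (measurePreserving_resample_snd (ν := Measure.pi fun _ : Fin n => cfg.pz)
      (measurePreserving_resample_snd
        (ν := Measure.pi fun _ : Fin n => (volume : Measure ℝ).restrict (Set.Icc 0 1)) hnoise))
  exact (hn.comp (hb.prod (MeasurePreserving.id (stdGaussian (E dw))))).comp
    (measurePreserving_prodAssoc (cfg.criticSeedLaw n)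
      (bernoulliMeasure true false (cfg.samplingRate n)) (stdGaussian (E dw))).symm

end Config

namespace Config

variable {p dw dθ n : ℕ} {Z : Type*} [MeasurableSpace Z]

/-- The sum of the clipped gradients and the noise, without entry `i` and the noise vector `j`. -/
noncomputable def restSum (cfg : Config p dw dθ Z) (d : Fin n → E p) (w : E dw) (θ : E dθ)
    (i : Fin n) (j : Fin cfg.r) (ω : cfg.CriticSeed n) : E dw :=
  (∑ l ∈ Finset.univ.erase i, if ω.1 l = true then
      clip cfg.C (cfg.sampleGrad (d l) w θ (ω.2.1 l) (ω.2.2.1 l)) else 0)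
    + ∑ l ∈ Finset.univ.erase j, ω.2.2.2 l

lemma restSum_congr (cfg : Config p dw dθ Z) {d d' : Fin n → E p} {i : Fin n}
    (hd : ∀ l, l ≠ i → d l = d' l) (w : E dw) (θ : E dθ) (j : Fin cfg.r) (ω : cfg.CriticSeed n) :
    cfg.restSum d w θ i j ω = cfg.restSum d' w θ i j ω := by
  unfold restSum
  congr 1
  exact Finset.sum_congr rfl fun l hl => by rw [hd l (Finset.ne_of_mem_erase hl)]

/-- The batch gradient as a function of the selection bit of entry `i` and of one noise vector. -/
lemma batchGrad_resample (cfg : Config p dw dθ Z) (hσC : cfg.σ * cfg.C ≠ 0) (d : Fin n → E p)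
    (w : E dw) (θ : E dθ) (i : Fin n) (j : Fin cfg.r) (ω : cfg.CriticSeed n)
    (y : Bool × E dw) :
    cfg.batchGrad d w θ (cfg.resample i j (ω, y)) =
      (1 / (cfg.m : ℝ)) • (cfg.restSum d w θ i j ω + (cfg.σ * cfg.C) •
        ((if y.1 = true then (cfg.σ * cfg.C)⁻¹ •
          clip cfg.C (cfg.sampleGrad (d i) w θ (ω.2.1 i) (ω.2.2.1 i)) else 0) + y.2)) := by
  unfold batchGrad restSum resample
  congr 1
  rw [← Finset.add_sum_erase Finset.univ _ (Finset.mem_univ i),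
    ← Finset.add_sum_erase Finset.univ _ (Finset.mem_univ j)]
  have h1 : ∀ l ∈ Finset.univ.erase i, Function.update ω.1 i y.1 l = ω.1 l := fun l hl =>
    Function.update_of_ne (Finset.ne_of_mem_erase hl) _ _
  have h2 : ∀ l ∈ Finset.univ.erase j,
      Function.update ω.2.2.2 j ((cfg.σ * cfg.C) • y.2) l = ω.2.2.2 l := fun l hl =>
    Function.update_of_ne (Finset.ne_of_mem_erase hl) _ _
  simp only [Function.update_self]
  rw [Finset.sum_congr rfl h2, Finset.sum_congr rfl fun l hl => by rw [h1 l hl], smul_add, smul_ite,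
    smul_inv_smul₀ hσC, smul_zero]
  abel

variable {cfg : Config p dw dθ Z} [IsProbabilityMeasure cfg.pz] {ρ : ℝ} {k : ℕ}

/-- One discriminator update. All randomness except the selection bit of the differing entry and one
noise vector is shared; given the rest, the update is a function of a subsampled Gaussian. -/
lemma holderDominated_criticUpdate (hcfg : cfg.IsMeasurable) (hρ : ρ.HolderConjugate (k + 2))
    (hr : 1 ≤ cfg.r) (hC : 0 < cfg.C) (hσ : 1 ≤ cfg.σ)
    (hqσ : cfg.samplingRate n * cfg.σ ≤ 1 / 16) (hk : (k : ℝ) ≤ cfg.σ ^ 2 / 64)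
    {d d' : Fin n → E p} (hd : Adjacent d d') (s : State dw dθ) :
    HolderDominated ρ (ENNReal.ofReal (Real.exp (momentConst * (k + 2) ^ 2 *
        ((cfg.samplingRate n : ℝ) ^ 2 / cfg.σ ^ 2) / (k + 2))))
      ((cfg.criticSeedLaw n).map (cfg.criticUpdate d s))
      ((cfg.criticSeedLaw n).map (cfg.criticUpdate d' s)) := by
  obtain ⟨i, hi⟩ := hd
  have hσ0 : 0 < cfg.σ := by linarith
  have hσC : 0 < cfg.σ * cfg.C := by positivity
  let j : Fin cfg.r := ⟨0, hr⟩
  have hR := cfg.measurePreserving_resample i j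
  have hU : ∀ d₁ : Fin n → E p, Measurable (cfg.criticUpdate d₁ s) := fun d₁ =>
    (measurable_criticUpdate hcfg d₁).comp measurable_prodMk_left
  have hbind : ∀ d₁ : Fin n → E p, (cfg.criticSeedLaw n).map (cfg.criticUpdate d₁ s) =
      (cfg.criticSeedLaw n).bind fun ω =>
        ((bernoulliMeasure true false (cfg.samplingRate n)).prod (stdGaussian (E dw))).map
          fun y => cfg.criticUpdate d₁ s (cfg.resample i j (ω, y)) := fun d₁ => by
    conv_lhs => rw [← hR.map_eq, Measure.map_map (hU d₁) hR.measurable]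
    exact map_prod_eq_bind _ _ ((hU d₁).comp hR.measurable)
  have hmeas : ∀ d₁ : Fin n → E p, Measurable fun ω =>
      ((bernoulliMeasure true false (cfg.samplingRate n)).prod (stdGaussian (E dw))).map
        fun y => cfg.criticUpdate d₁ s (cfg.resample i j (ω, y)) := fun d₁ =>
    measurable_map_prodMk _ ((hU d₁).comp hR.measurable)
  rw [hbind d, hbind d', ← one_mul (ENNReal.ofReal _)]
  refine (HolderDominated.refl hρ.lt _).bind hρ.lt (hmeas d) (hmeas d') fun ω => ?_
  let F : E dw → State dw dθ := fun x => cfg.criticStep s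
    ((1 / (cfg.m : ℝ)) • (cfg.restSum d s.1 s.2.2.1 i j ω + (cfg.σ * cfg.C) • x))
  have hF : Measurable F := by
    have h0 : Measurable fun x : E dw => (s, (1 / (cfg.m : ℝ)) •
      (cfg.restSum d s.1 s.2.2.1 i j ω + (cfg.σ * cfg.C) • x)) := by fun_prop
    exact cfg.measurable_criticStep.comp h0
  let v : (Fin n → E p) → E dw := fun d₁ => (cfg.σ * cfg.C)⁻¹ •
    clip cfg.C (cfg.sampleGrad (d₁ i) s.1 s.2.2.1 (ω.2.1 i) (ω.2.2.1 i))
  have hv : ∀ d₁, ‖v d₁‖ ≤ 1 / cfg.σ := fun d₁ => by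
    rw [norm_smul, norm_inv, Real.norm_of_nonneg hσC.le, inv_mul_le_iff₀ hσC]
    refine (norm_clip_le hC _).trans (le_of_eq ?_)
    field_simp
  have hmap : ∀ d₁ : Fin n → E p, (∀ l, l ≠ i → d l = d₁ l) →
      (((bernoulliMeasure true false (cfg.samplingRate n)).prod (stdGaussian (E dw))).map
        fun y => cfg.criticUpdate d₁ s (cfg.resample i j (ω, y))) =
      (subsampledGaussian (cfg.samplingRate n) (v d₁)).map F := fun d₁ h => by
    rw [subsampledGaussian, Measure.map_map hF (measurable_select_add _)]
    congr 1
    ext1 y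
    change cfg.criticStep s (cfg.batchGrad d₁ s.1 s.2.2.1 (cfg.resample i j (ω, y))) =
      cfg.criticStep s _
    rw [cfg.batchGrad_resample hσC.ne', cfg.restSum_congr h]
  rw [hmap d fun _ _ => rfl, hmap d' hi]
  exact (holderDominated_subsampledGaussian hρ hσ hqσ hk (hv d) (hv d')).map hF

lemma measurable_criticLoop (hcfg : cfg.IsMeasurable) (d : Fin n → E p) (j : ℕ) :
    Measurable fun s => cfg.criticLoop d j s := by
  induction j with
  | zero => exact Measure.measurable_dirac
  | succ j ih =>
    exact (Measure.measurable_bind' ih).comp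
      (measurable_map_prodMk _ (measurable_criticUpdate hcfg d))

lemma measurable_generatorLaw (hcfg : cfg.IsMeasurable) (k : ℕ) :
    Measurable fun s => (Measure.pi fun _ : Fin cfg.m => cfg.pz).map (cfg.generatorUpdate k s) :=
  measurable_map_prodMk _ (measurable_generatorUpdate hcfg k)

lemma measurable_mainIteration (hcfg : cfg.IsMeasurable) (d : Fin n → E p) (k : ℕ) :
    Measurable fun s => cfg.mainIteration d k s :=
  (Measure.measurable_bind' (measurable_generatorLaw hcfg k)).comp
    (measurable_criticLoop hcfg d cfg.nCritic)

lemma measurable_mainLoop (hcfg : cfg.IsMeasurable) (d : Fin n → E p) (t k : ℕ) :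
    Measurable fun s => cfg.mainLoop d t k s := by
  induction t generalizing k with
  | zero => exact Measure.measurable_dirac
  | succ t ih =>
    unfold mainLoop
    refine Measurable.ite ?_ Measure.measurable_dirac ?_
    · exact (by fun_prop : Measurable fun s : State dw dθ => s.2.2.2.2) (hcfg.converged k)
    · refine (Measure.measurable_bind' ?_).comp (measurable_mainIteration hcfg d k)
      split_ifs
      · exact Measure.measurable_dirac
      · exact ih (k + 1)

variable {A : ℝ≥0∞} {d d' : Fin n → E p}

lemma holderDominated_criticLoop (hcfg : cfg.IsMeasurable) (hρ : 1 < ρ)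
    (h : ∀ s, HolderDominated ρ A ((cfg.criticSeedLaw n).map (cfg.criticUpdate d s))
      ((cfg.criticSeedLaw n).map (cfg.criticUpdate d' s))) (j : ℕ) (s : State dw dθ) :
    HolderDominated ρ (A ^ j) (cfg.criticLoop d j s) (cfg.criticLoop d' j s) := by
  induction j generalizing s with
  | zero => rw [pow_zero]; exact HolderDominated.refl hρ (Measure.dirac s)
  | succ j ih =>
    rw [pow_succ']
    exact (h s).bind hρ (measurable_criticLoop hcfg d j) (measurable_criticLoop hcfg d' j) ih

/-- The generator update does not touch the database: it is post-processing. -/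
lemma holderDominated_mainIteration (hcfg : cfg.IsMeasurable) (hρ : 1 < ρ)
    (h : ∀ s, HolderDominated ρ A ((cfg.criticSeedLaw n).map (cfg.criticUpdate d s))
      ((cfg.criticSeedLaw n).map (cfg.criticUpdate d' s))) (k : ℕ) (s : State dw dθ) :
    HolderDominated ρ (A ^ cfg.nCritic) (cfg.mainIteration d k s) (cfg.mainIteration d' k s) := by
  rw [← mul_one (A ^ _)]
  refine (holderDominated_criticLoop hcfg hρ h cfg.nCritic s).bind hρ
    (measurable_generatorLaw hcfg k) (measurable_generatorLaw hcfg k) fun s' => ?_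
  have : IsProbabilityMeasure
      ((Measure.pi fun _ : Fin cfg.m => cfg.pz).map (cfg.generatorUpdate k s')) :=
    Measure.isProbabilityMeasure_map
      ((measurable_generatorUpdate hcfg k).comp measurable_prodMk_left).aemeasurable
  exact HolderDominated.refl hρ _

/-- Stopping early only saves privacy budget, because the constant of each step is at least `1`. -/
lemma holderDominated_mainLoop (hcfg : cfg.IsMeasurable) (hρ : 1 < ρ) (hA : 1 ≤ A)
    (h : ∀ s, HolderDominated ρ A ((cfg.criticSeedLaw n).map (cfg.criticUpdate d s))
      ((cfg.criticSeedLaw n).map (cfg.criticUpdate d' s))) (t k : ℕ) (s : State dw dθ) :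
    HolderDominated ρ (A ^ (cfg.nCritic * t)) (cfg.mainLoop d t k s) (cfg.mainLoop d' t k s) := by
  have hdirac : ∀ (l : ℕ) (s : State dw dθ),
      HolderDominated ρ (A ^ l) (Measure.dirac s) (Measure.dirac s) := fun l s =>
    (HolderDominated.refl hρ _).mono (one_le_pow₀ hA)
  induction t generalizing k s with
  | zero => exact hdirac _ s
  | succ t ih =>
    unfold mainLoop
    split_ifs
    · exact hdirac _ s
    · rw [mul_add, mul_one, add_comm, pow_add]
      exact (holderDominated_mainIteration hcfg hρ h k s).bind hρ Measure.measurable_dirac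
        Measure.measurable_dirac (hdirac _)
    · rw [mul_add, mul_one, add_comm, pow_add]
      exact (holderDominated_mainIteration hcfg hρ h k s).bind hρ
        (measurable_mainLoop hcfg d t (k + 1)) (measurable_mainLoop hcfg d' t (k + 1)) (ih (k + 1))

lemma holderDominated_output (hcfg : cfg.IsMeasurable) (hρ : 1 < ρ) (hA : 1 ≤ A)
    (h : ∀ s, HolderDominated ρ A ((cfg.criticSeedLaw n).map (cfg.criticUpdate d s))
      ((cfg.criticSeedLaw n).map (cfg.criticUpdate d' s))) (t : ℕ) :
    HolderDominated ρ (A ^ (cfg.nCritic * t)) (cfg.output t d) (cfg.output t d') :=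
  (holderDominated_mainLoop hcfg hρ hA h t 0 cfg.init).map (by fun_prop)

end Config

/-! ### Choice of the order and conclusion -/

/-- The choice of the order `k + 2` of the divergence: `k + 1` is `b L / e` rounded down, but at
least `1`, where `L = log (1 / δ)`, `e = q ε √T` and `b = 1 / (32 c)`. The condition `e ≤ c q² T` and the
bound on the noise scale give the upper bound on `k`; the condition `e ≤ c L` shows that raising
`k + 1` to `1` changes it by a bounded factor only. -/
lemma exists_order {c ε δ q σ T : ℝ} (hc : 0 < c) (hε : 0 < ε) (hδ : 0 < δ) (hδ1 : δ < 1)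
    (hq : 0 < q) (hσ : 1 ≤ σ) (hT : 0 < T) (hnoise : Real.sqrt (2 * Real.log (1.25 / δ)) / ε ≤ σ)
    (h1 : q * ε * Real.sqrt T ≤ c * (q ^ 2 * T))
    (h2 : q * ε * Real.sqrt T ≤ c * Real.log (1 / δ)) {A K : ℝ} (hA : 0 ≤ A)
    (hK : K = 64 * c * (1 + 2 * A * (1 / (32 * c) + c) ^ 2)) :
    ∃ k : ℕ, (k : ℝ) ≤ σ ^ 2 / 64 ∧
      T * (A * (k + 2) ^ 2 * (q ^ 2 / σ ^ 2)) - (k + 1) * (K * (q * ε * Real.sqrt T)) ≤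
        Real.log δ := by
  have hσ0 : 0 < σ := by linarith
  set L := Real.log (1 / δ) with hL
  have hL0 : 0 < L := Real.log_pos (by rw [lt_div_iff₀ hδ]; linarith)
  have hLδ : Real.log δ = -L := by rw [hL, one_div, Real.log_inv, neg_neg]
  set R := Real.sqrt T with hR
  have hR0 : 0 < R := Real.sqrt_pos.2 hT
  have hRT : R ^ 2 = T := Real.sq_sqrt hT.le
  set e := q * ε * R with he
  have he0 : 0 < e := by positivity
  -- the noise scale in terms of `L`
  have hLσ : 2 * L ≤ σ ^ 2 * ε ^ 2 := by
    have h3 : Real.sqrt (2 * Real.log (1.25 / δ)) ≤ σ * ε := (div_le_iff₀ hε).1 hnoise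
    have h4 : L ≤ Real.log (1.25 / δ) :=
      Real.log_le_log (by positivity) (by gcongr; norm_num)
    have h5 := (Real.sqrt_le_left (by positivity)).1 h3
    rw [mul_pow] at h5
    linarith
  have hεR : ε ≤ c * q * R := by
    have : e * 1 ≤ (q * R) * (c * q * R) := by rw [← hRT] at h1; linarith
    rw [he] at this
    refine le_of_mul_le_mul_left ?_ (by positivity : 0 < q * R)
    linarith
  have hLe : L / e ≤ c * σ ^ 2 / 2 := by
    rw [div_le_iff₀ he0]
    have : ε * ε ≤ ε * (c * q * R) := by gcongr
    have := mul_le_mul_of_nonneg_left this (sq_nonneg σ)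
    rw [he]
    nlinarith
  have hone : 1 ≤ c * (L / e) := by
    rw [← mul_div_assoc, le_div_iff₀ he0, one_mul]
    exact h2
  set b := 1 / (32 * c) with hb
  have hb0 : 0 < b := by positivity
  have hbc : b * c = 1 / 32 := by rw [hb]; field_simp
  set x := b * (L / e) with hx
  have hx0 : 0 < x := by positivity
  have hxσ : x ≤ σ ^ 2 / 64 := by
    calc x ≤ b * (c * σ ^ 2 / 2) := by rw [hx]; gcongr
      _ = b * c * σ ^ 2 / 2 := by ring
      _ = _ := by rw [hbc]; ring
  refine ⟨⌊x⌋₊ - 1, ?_, ?_⟩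
  · calc ((⌊x⌋₊ - 1 : ℕ) : ℝ) ≤ (⌊x⌋₊ : ℝ) := by exact_mod_cast Nat.sub_le _ _
      _ ≤ x := Nat.floor_le hx0.le
      _ ≤ _ := hxσ
  · set k : ℕ := ⌊x⌋₊ - 1 with hk
    have hk0 : (0 : ℝ) ≤ k := k.cast_nonneg
    have hlow : x / 2 ≤ (k : ℝ) + 1 := by
      have h3 := Nat.lt_floor_add_one x
      have h4 : (⌊x⌋₊ : ℝ) ≤ k + 1 := by exact_mod_cast (by omega : ⌊x⌋₊ ≤ k + 1)
      linarith
    have hup : (k : ℝ) + 1 ≤ (b + c) * (L / e) := by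
      rcases Nat.eq_zero_or_pos ⌊x⌋₊ with h0 | h0
      · have : k = 0 := by omega
        rw [this, add_mul]
        push_cast
        linarith
      · have h3 : ((k + 1 : ℕ) : ℝ) = ⌊x⌋₊ := by rw [hk, Nat.sub_add_cancel h0]
        push_cast at h3
        rw [h3, add_mul]
        linarith [Nat.floor_le hx0.le]
    have hmom : T * (q ^ 2 / σ ^ 2) ≤ e ^ 2 / (2 * L) := by
      rw [← mul_div_assoc, div_le_div_iff₀ (by positivity) (by positivity), ← hRT, he]
      have := mul_le_mul_of_nonneg_left hLσ (by positivity : 0 ≤ R ^ 2 * q ^ 2)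
      linarith
    have hfirst : T * (A * (k + 2) ^ 2 * (q ^ 2 / σ ^ 2)) ≤ 2 * A * (b + c) ^ 2 * L := by
      have h3 : (k : ℝ) + 2 ≤ 2 * ((b + c) * (L / e)) := by linarith
      calc T * (A * (k + 2) ^ 2 * (q ^ 2 / σ ^ 2))
          = A * (k + 2) ^ 2 * (T * (q ^ 2 / σ ^ 2)) := by ring
        _ ≤ A * (2 * ((b + c) * (L / e))) ^ 2 * (e ^ 2 / (2 * L)) := by gcongr
        _ = _ := by field_simp
    have hK0 : 0 ≤ K := by rw [hK]; positivity
    have hsecond : (1 + 2 * A * (b + c) ^ 2) * L ≤ (k + 1) * (K * e) := by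
      calc (1 + 2 * A * (b + c) ^ 2) * L = x / 2 * (K * e) := by
            rw [hK, hx, hb]; field_simp; norm_num
        _ ≤ _ := by gcongr
    rw [hLδ]
    linarith

/-- Differential privacy of the procedure, for every order `k + 2` of the divergence in the range of
the moment bound. -/
theorem isDP_output {p dw dθ n t : ℕ} {Z : Type*} [MeasurableSpace Z] {cfg : Config p dw dθ Z}
    [IsProbabilityMeasure cfg.pz] (hcfg : cfg.IsMeasurable) {ε δ : ℝ} {k : ℕ}
    (hr : 1 ≤ cfg.r) (hC : 0 < cfg.C) (hσ : 1 ≤ cfg.σ)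
    (hqσ : cfg.samplingRate n * cfg.σ ≤ 1 / 16) (hk : (k : ℝ) ≤ cfg.σ ^ 2 / 64)
    (hδ0 : 0 < δ)
    (hδ : (cfg.nCritic * t : ℝ) * (momentConst * (k + 2) ^ 2 *
      ((cfg.samplingRate n : ℝ) ^ 2 / cfg.σ ^ 2)) - (k + 1) * ε ≤ Real.log δ) :
    IsDP (fun d : Fin n → E p => cfg.output t d) ε δ := by
  intro d d' hd S hS
  have hconj : ((k : ℝ) + 2).HolderConjugate ((k : ℝ) + 2).conjExponent :=
    Real.HolderConjugate.conjExponent (by linarith [(k.cast_nonneg : (0 : ℝ) ≤ k)])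
  have hm := momentConst_pos
  have h := Config.holderDominated_output hcfg hconj.symm.lt
    (ENNReal.one_le_ofReal.2 (Real.one_le_exp (by positivity)))
    (Config.holderDominated_criticUpdate hcfg hconj.symm hr hC hσ hqσ hk hd) t
  rw [← ENNReal.ofReal_pow (Real.exp_pos _).le, ← Real.exp_nat_mul, ← mul_div_assoc] at h
  refine h.measure_le hconj.symm ?_ hS
  rw [← Real.le_log_iff_exp_le hδ0]
  push_cast
  linarith

end DPGAN

theorem theorem1 (c : ℝ) (hc : 0 < c) :
    ∃ K : ℝ, 0 < K ∧
      ∀ (p dw dθ n t : ℕ) (Z : Type*) [MeasurableSpace Z] (cfg : DPGAN.Config p dw dθ Z)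
        (ε δ q : ℝ),
        IsProbabilityMeasure cfg.pz →
        (∀ x : DPGAN.E p, Measurable fun u : DPGAN.E dw × DPGAN.E dθ × Z × ℝ =>
          cfg.sampleGrad x u.1 u.2.1 u.2.2.1 u.2.2.2) →
        (Measurable fun u : DPGAN.E dw × DPGAN.E dθ × (Fin cfg.m → Z) =>
          cfg.generatorGrad u.1 u.2.1 u.2.2) →
        (∀ k : ℕ, MeasurableSet {h : ℕ → DPGAN.E dθ | cfg.converged k h}) →
        1 ≤ t → 1 ≤ cfg.nCritic → 1 ≤ cfg.m → 1 ≤ cfg.r → 0 < cfg.C →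
        0 < ε → 0 < δ → δ < 1 →
        q = (cfg.m : ℝ) / n →
        Real.sqrt (2 * Real.log (1.25 / δ)) / ε ≤ cfg.σ →
        1 ≤ cfg.σ → q * cfg.σ ≤ 1 / 16 →
        q * ε * Real.sqrt (cfg.nCritic * t) ≤ c * (q ^ 2 * (cfg.nCritic * t)) →
        q * ε * Real.sqrt (cfg.nCritic * t) ≤ c * Real.log (1 / δ) →
        DPGAN.IsDP (fun d : Fin n → DPGAN.E p => cfg.output t d)
          (K * (q * ε * Real.sqrt (cfg.nCritic * t))) δ := by
  have hA := DPGAN.momentConst_pos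
  refine ⟨64 * c * (1 + 2 * DPGAN.momentConst * (1 / (32 * c) + c) ^ 2), by positivity, ?_⟩
  intro p dw dθ n t Z _ cfg ε δ q hpz hs hg hconv ht hn hm hr hC hε hδ hδ1 hq hnoise hσ hqσ h1 h2
  rcases Nat.eq_zero_or_pos n with rfl | hn0
  · -- a database without entries has no neighbour, not even itself
    rintro d d' ⟨i, -⟩
    exact i.elim0
  have hm' : (0 : ℝ) < cfg.m := by exact_mod_cast hm
  have hn' : (0 : ℝ) < n := by exact_mod_cast hn0
  have hT : (0 : ℝ) < cfg.nCritic * t := by exact_mod_cast Nat.mul_pos hn ht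
  have hq0 : 0 < q := hq ▸ div_pos hm' hn'
  have hq1 : q ≤ 1 := by nlinarith
  have hrate : (cfg.samplingRate n : ℝ) = q := by
    rw [DPGAN.Config.samplingRate, Set.coe_projIcc, ← hq, min_eq_right hq1, max_eq_right hq0.le]
  obtain ⟨k, hk, hle⟩ := DPGAN.exists_order hc hε hδ hδ1 hq0 hσ hT hnoise h1 h2 hA.le rfl
  exact DPGAN.isDP_output ⟨hs, hg, hconv⟩ hr hC hσ (by rwa [hrate]) hk hδ (by rwa [hrate])
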